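/- Let $\Omega\subseteq\hat\Omega\subseteq\mathbb R^N$ be bounded domains (nonempty, open, connected) with $C^1$-boundaries (equality $\Omega=\hat\Omega$ is allowed) and let $1<p<\infty$. Let $Q_i:\Omega\times\mathbb R^N\to\mathbb R$ and $Q_e:\hat\Omega\times\mathbb R^N\to\mathbb R$ be measurable in the first variable, differentiable and strictly convex in the second variable, with $Q_i(x,0)=0$, $Q_e(x,0)=0$, and such that for some $\alpha>0$ one has $Q_i(x,y)\ge\alpha|y|^p$ for all $x\in\Omega$, $y\in\mathbb R^N$ and $Q_e(x,y)\ge\alpha|y|^p$ for all $x\in\hat\Omega$, $y\in\mathbb R^N$. Let $F\in C^1(\mathbb R^2)$ be semiconvex, that is, $(u,w)\mapsto F(u,w)+\frac{\omega_0}{2}(u^2+w^2)$ is convex for some $\omega_0\in\mathbb R$. Let $$V=\Big\{(u_i,u_e,w)\in W^{1,p}(\Omega)\times W^{1,p}(\hat\Omega)\times L^2(\Omega):\ \int_\Omega u_e=0,\ u_i-u_e|_\Omega\in L^2(\Omega)\Big\},$$ with the norm $\max\{\|u_i\|_{W^{1,p}(\Omega)},\|u_e\|_{W^{1,p}(\hat\Omega)},\|w\|_{L^2(\Omega)},\|u_i-u_e|_\Omega\|_{L^2(\Omega)}\}$,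 where $\|u\|_{W^{1,p}}=\max\{\|u\|_{L^p},\|\nabla u\|_{L^p}\}$. Let $H=L^2(\Omega)\times L^2(\Omega)$ with its Hilbert space norm, let $j:V\to H$ be the bounded linear map $j(u_i,u_e,w)=(u_i-u_e|_\Omega,w)$, and let $$\mathcal E(u_i,u_e,w)=\int_\Omega Q_i(x,\nabla u_i)\,dx+\int_{\hat\Omega}Q_e(x,\nabla u_e)\,dx+\int_\Omega F(u_i-u_e,w)\,dx .$$ Then: 1. The three integrals exist in $\mathbb R\cup\{+\infty\}$ for all $(u_i,u_e,w)\in V$, so that $\mathcal E:V\to\mathbb R\cup\{+\infty\}$ is well defined, and $\mathcal E$ is lower semicontinuous. 2. $\mathcal E$ is $j$-elliptic: there is $\omega\in\mathbb R$ such that $\mathcal E_\omega:=\mathcal E+\frac{\omega}{2}\|j(\cdot)\|_H^2$ is convex and coercive, the latter meaning that for every $c\in\mathbb R$ the sublevel set $\{\mathcal E_\omega\le c\}$ is relatively weakly compact in $V$. 3. The effective domain $\operatorname{dom}\mathcal E:=\{\mathcal E<+\infty\}$ is the set of all $(u_i,u_e,w)\in V$ for which $\int_\Omega Q_i(x,\nabla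 u_i)$, $\int_{\hat\Omega}Q_e(x,\nabla u_e)$ and $\int_\Omega F(u_i-u_e,w)$ are all $<+\infty$. 4. If, in addition, $Q_i(\cdot,y)\in L^1_{\mathrm{loc}}(\Omega)$ for every $y\in\mathbb R^N$, then $j(\operatorname{dom}\mathcal E)$ is dense in $L^2(\Omega)\times L^2(\Omega)$. -/

import Mathlib

open MeasureTheory Filter Topology
open scoped ENNReal

noncomputable section

namespace Bidomain

/-- `ℝᴺ` with the Euclidean norm. -/
abbrev Eucl (N : ℕ) := EuclideanSpace ℝ (Fin N)

/-- Lebesgue measure on `Ω`. -/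
abbrev leb {N : ℕ} (Ω : Set (Eucl N)) : Measure (Eucl N) := volume.restrict Ω

/-- `Ω` has a `C¹`-boundary: near each boundary point, `Ω` is the region strictly above the graph
of a `C¹` function, in an orthonormal coordinate system with "vertical" direction `e`
(the remaining coordinates are those of the hyperplane `e⊥`). -/
def HasC1Boundary {N : ℕ} (Ω : Set (Eucl N)) : Prop :=
  ∀ x₀ ∈ frontier Ω, ∃ r > (0 : ℝ), ∃ e : Eucl N, ‖e‖ = 1 ∧
    ∃ γ : (Submodule.span ℝ {e})ᗮ → ℝ, ContDiff ℝ 1 γ ∧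
      ∀ x ∈ Metric.ball x₀ r,
        x ∈ Ω ↔ γ ((Submodule.span ℝ {e})ᗮ.orthogonalProjectionOnto x) < inner ℝ e x

/-- A bounded domain (nonempty, open, connected) with `C¹`-boundary. -/
structure IsC1Domain {N : ℕ} (Ω : Set (Eucl N)) : Prop where
  isOpen : IsOpen Ω
  isConnected : IsConnected Ω
  isBounded : Bornology.IsBounded Ω
  hasC1Boundary : HasC1Boundary Ω

/-- `g` is the weak gradient of `u` on `Ω`. -/
def IsWeakGradient {N : ℕ} (Ω : Set (Eucl N)) (u : Eucl N → ℝ) (g : Eucl N → Eucl N) : Prop :=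
  ∀ φ : Eucl N → ℝ, ContDiff ℝ (⊤ : ℕ∞) φ → HasCompactSupport φ → tsupport φ ⊆ Ω →
    ∀ y : Eucl N, ∫ x in Ω, fderiv ℝ φ x y * u x = - ∫ x in Ω, φ x * inner ℝ (g x) y

theorem integrable_testFunction_mul {N : ℕ} {p : ℝ≥0∞} (hp : 1 ≤ p) {Ω : Set (Eucl N)}
    {f u : Eucl N → ℝ} (hf : Continuous f) (hf' : HasCompactSupport f) (hu : MemLp u p (leb Ω)) :
    Integrable (fun x => f x * u x) (leb Ω) := by
  simpa using (hu.locallyIntegrable hp).integrable_smul_left_of_hasCompactSupport hf hf'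

/-- The Sobolev space `W^{1,p}(Ω)`, as the space of pairs `(u, ∇u)` in `Lᵖ(Ω) × Lᵖ(Ω; ℝᴺ)`, where
`∇u` is the weak gradient of `u`; the norm is `max ‖u‖_p ‖∇u‖_p`. -/
def Sobolev {N : ℕ} (p : ℝ≥0∞) [Fact (1 ≤ p)] (Ω : Set (Eucl N)) :
    Submodule ℝ (Lp ℝ p (leb Ω) × Lp (Eucl N) p (leb Ω)) where
  carrier := {u | IsWeakGradient Ω u.1 u.2}
  zero_mem' := by
    intro φ _ _ _ y
    have h1 : ∫ x in Ω, fderiv ℝ φ x y * (0 : Lp ℝ p (leb Ω)) x = 0 := by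
      refine integral_eq_zero_of_ae ?_
      filter_upwards [Lp.coeFn_zero ℝ p (leb Ω)] with x hx
      rw [hx]; simp
    have h2 : ∫ x in Ω, φ x * inner ℝ ((0 : Lp (Eucl N) p (leb Ω)) x) y = 0 := by
      refine integral_eq_zero_of_ae ?_
      filter_upwards [Lp.coeFn_zero (Eucl N) p (leb Ω)] with x hx
      rw [hx]; simp
    exact h1.trans (by rw [← neg_zero, ← h2]; rfl)
  add_mem' := by
    rintro ⟨u, g⟩ ⟨v, h⟩ hu hv φ hφ hφc hφs y
    have hp : (1 : ℝ≥0∞) ≤ p := Fact.out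
    have hd : Continuous fun x => fderiv ℝ φ x y :=
      (hφ.continuous_fderiv (by simp)).clm_apply continuous_const
    have hdc : HasCompactSupport fun x => fderiv ℝ φ x y := hφc.fderiv_apply ℝ y
    have e1 : ∫ x in Ω, fderiv ℝ φ x y * (u + v : Lp ℝ p (leb Ω)) x =
        (∫ x in Ω, fderiv ℝ φ x y * u x) + ∫ x in Ω, fderiv ℝ φ x y * v x := by
      rw [← integral_add (integrable_testFunction_mul hp hd hdc (Lp.memLp u))
        (integrable_testFunction_mul hp hd hdc (Lp.memLp v))]
      refine integral_congr_ae ?_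
      filter_upwards [Lp.coeFn_add u v] with x hx
      rw [hx, Pi.add_apply, mul_add]
    have e2 : ∫ x in Ω, φ x * inner ℝ ((g + h : Lp (Eucl N) p (leb Ω)) x) y =
        (∫ x in Ω, φ x * inner ℝ (g x) y) + ∫ x in Ω, φ x * inner ℝ (h x) y := by
      rw [← integral_add
        (integrable_testFunction_mul hp hφ.continuous hφc ((Lp.memLp g).inner_const y))
        (integrable_testFunction_mul hp hφ.continuous hφc ((Lp.memLp h).inner_const y))]
      refine integral_congr_ae ?_
      filter_upwards [Lp.coeFn_add g h] with x hx
      rw [hx, Pi.add_apply, inner_add_left, mul_add]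
    have a1 := hu φ hφ hφc hφs y
    have a2 := hv φ hφ hφc hφs y
    simp only [Prod.mk_add_mk] at a1 a2 ⊢
    rw [e1, e2, a1, a2]
    ring
  smul_mem' := by
    rintro c ⟨u, g⟩ hu φ hφ hφc hφs y
    have e1 : ∫ x in Ω, fderiv ℝ φ x y * (c • u : Lp ℝ p (leb Ω)) x =
        c * ∫ x in Ω, fderiv ℝ φ x y * u x := by
      rw [← integral_const_mul]
      refine integral_congr_ae ?_
      filter_upwards [Lp.coeFn_smul c u] with x hx
      simp [hx]; ring
    have e2 : ∫ x in Ω, φ x * inner ℝ ((c • g : Lp (Eucl N) p (leb Ω)) x) y =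
        c * ∫ x in Ω, φ x * inner ℝ (g x) y := by
      rw [← integral_const_mul]
      refine integral_congr_ae ?_
      filter_upwards [Lp.coeFn_smul c g] with x hx
      simp [hx, inner_smul_left]; ring
    have a1 := hu φ hφ hφc hφs y
    simp only [Prod.smul_mk] at a1 ⊢
    rw [e1, e2, a1]
    ring

/-- The real Hilbert space `L²(Ω) × L²(Ω)`. -/
abbrev HilbertL2 {N : ℕ} (Ω : Set (Eucl N)) :=
  WithLp 2 (Lp ℝ 2 (leb Ω) × Lp ℝ 2 (leb Ω))

theorem integrable_restrict {N : ℕ} {p : ℝ≥0∞} (hp : 1 ≤ p) {Ω Ω' : Set (Eucl N)} (hΩ : Ω ⊆ Ω')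
    (hb : Bornology.IsBounded Ω) (u : Lp ℝ p (leb Ω')) : Integrable u (leb Ω) := by
  have : IsFiniteMeasure (leb Ω) := ⟨by simpa using hb.measure_lt_top⟩
  exact ((Lp.memLp u).mono_measure (Measure.restrict_mono hΩ le_rfl)).integrable hp

/-- The energy space `V` of all `(u_i, u_e, w)` in `W^{1,p}(Ω) × W^{1,p}(Ω') × L²(Ω)` such that
`∫_Ω u_e = 0` and `u_i - u_e|_Ω ∈ L²(Ω)`. The `L²` class `v` of `u_i - u_e|_Ω` is recorded as a
fourth component (which is determined by the first two), so that the norm inherited from the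
product is the canonical one,
`max (‖u_i‖_{W^{1,p}}) (‖u_e‖_{W^{1,p}}) (‖w‖_{L²}) (‖u_i - u_e‖_{L²})`. -/
def EnergySpace {N : ℕ} (p : ℝ≥0∞) [Fact (1 ≤ p)] {Ω Ω' : Set (Eucl N)} (hΩ : Ω ⊆ Ω')
    (hb : Bornology.IsBounded Ω) :
    Submodule ℝ (Sobolev p Ω × Sobolev p Ω' × Lp ℝ 2 (leb Ω) × Lp ℝ 2 (leb Ω)) where
  carrier := {z | ∫ x in Ω, z.2.1.1.1 x = 0 ∧
    z.2.2.2 =ᵐ[leb Ω] fun x => z.1.1.1 x - z.2.1.1.1 x}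
  zero_mem' := by
    have h0 : ((0 : Lp ℝ p (leb Ω')) : Eucl N → ℝ) =ᵐ[leb Ω] 0 :=
      ae_mono (Measure.restrict_mono hΩ le_rfl) (Lp.coeFn_zero ℝ p (leb Ω'))
    refine ⟨integral_eq_zero_of_ae h0, ?_⟩
    filter_upwards [h0, Lp.coeFn_zero ℝ p (leb Ω), Lp.coeFn_zero ℝ 2 (leb Ω)] with x h1 h2 h3
    refine h3.trans ?_
    refine Eq.trans ?_ (congrArg₂ (· - ·) h2 h1).symm
    simp
  add_mem' := by
    rintro ⟨a, b, w, v⟩ ⟨a', b', w', v'⟩ ⟨h1, h2⟩ ⟨h1', h2'⟩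
    have hp : (1 : ℝ≥0∞) ≤ p := Fact.out
    have h0 : ((b.1.1 + b'.1.1 : Lp ℝ p (leb Ω')) : Eucl N → ℝ) =ᵐ[leb Ω]
        fun x => b.1.1 x + b'.1.1 x :=
      ae_mono (Measure.restrict_mono hΩ le_rfl) (Lp.coeFn_add b.1.1 b'.1.1)
    refine ⟨?_, ?_⟩
    · have e : ∫ x in Ω, (b.1.1 + b'.1.1 : Lp ℝ p (leb Ω')) x = 0 := by
        rw [integral_congr_ae h0, integral_add (integrable_restrict hp hΩ hb _)
          (integrable_restrict hp hΩ hb _)]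
        simp only at h1 h1'
        rw [h1, h1', add_zero]
      simpa using e
    · filter_upwards [h0, h2, h2', Lp.coeFn_add a.1.1 a'.1.1, Lp.coeFn_add v v']
        with x k0 k1 k2 k3 k4
      simp only [Prod.mk_add_mk, Submodule.coe_add, Prod.fst_add] at k0 k1 k2 k3 k4 ⊢
      rw [k0, k3, k4, Pi.add_apply, Pi.add_apply, k1, k2]
      ring
  smul_mem' := by
    rintro c ⟨a, b, w, v⟩ ⟨h1, h2⟩
    have h0 : ((c • b.1.1 : Lp ℝ p (leb Ω')) : Eucl N → ℝ) =ᵐ[leb Ω] fun x => c * b.1.1 x :=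
      ae_mono (Measure.restrict_mono hΩ le_rfl) (Lp.coeFn_smul c b.1.1)
    refine ⟨?_, ?_⟩
    · have e : ∫ x in Ω, (c • b.1.1 : Lp ℝ p (leb Ω')) x = 0 := by
        rw [integral_congr_ae h0, integral_const_mul]
        simp only at h1
        rw [h1, mul_zero]
      simpa using e
    · filter_upwards [h0, h2, Lp.coeFn_smul c a.1.1, Lp.coeFn_smul c v] with x k0 k1 k2 k3
      simp only [Prod.smul_mk, Submodule.coe_smul, Prod.smul_fst] at k0 k1 k2 k3 ⊢
      rw [k0, k2, k3, Pi.smul_apply, Pi.smul_apply, k1]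
      simp only [smul_eq_mul]
      ring

section Components

variable {N : ℕ} {p : ℝ≥0∞} [Fact (1 ≤ p)] {Ω Ω' : Set (Eucl N)} {hΩ : Ω ⊆ Ω'}
  {hb : Bornology.IsBounded Ω}

/-- The component `u_i` of `z = (u_i, u_e, w)`. -/
def uᵢ (z : EnergySpace p hΩ hb) : Eucl N → ℝ := z.1.1.1.1

/-- The weak gradient of `u_i`. -/
def gradUᵢ (z : EnergySpace p hΩ hb) : Eucl N → Eucl N := z.1.1.1.2

/-- The component `u_e` of `z = (u_i, u_e, w)`. -/
def uₑ (z : EnergySpace p hΩ hb) : Eucl N → ℝ := z.1.2.1.1.1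

/-- The weak gradient of `u_e`. -/
def gradUₑ (z : EnergySpace p hΩ hb) : Eucl N → Eucl N := z.1.2.1.1.2

/-- The component `w` of `z = (u_i, u_e, w)`. -/
def wComp (z : EnergySpace p hΩ hb) : Eucl N → ℝ := z.1.2.2.1

end Components

/-- The map `j : V → L²(Ω) × L²(Ω)`, `j (u_i, u_e, w) = (u_i - u_e|_Ω, w)`. -/
def jMap {N : ℕ} (p : ℝ≥0∞) [Fact (1 ≤ p)] {Ω Ω' : Set (Eucl N)} (hΩ : Ω ⊆ Ω')
    (hb : Bornology.IsBounded Ω) : EnergySpace p hΩ hb →L[ℝ] HilbertL2 Ω :=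
  ((WithLp.prodContinuousLinearEquiv 2 ℝ (Lp ℝ 2 (leb Ω)) (Lp ℝ 2 (leb Ω))).symm :
      (Lp ℝ 2 (leb Ω) × Lp ℝ 2 (leb Ω)) →L[ℝ] HilbertL2 Ω) ∘L
    ContinuousLinearMap.prod
      (ContinuousLinearMap.snd ℝ _ _ ∘L ContinuousLinearMap.snd ℝ _ _ ∘L
        ContinuousLinearMap.snd ℝ _ _ ∘L (EnergySpace p hΩ hb).subtypeL)
      (ContinuousLinearMap.fst ℝ _ _ ∘L ContinuousLinearMap.snd ℝ _ _ ∘L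
        ContinuousLinearMap.snd ℝ _ _ ∘L (EnergySpace p hΩ hb).subtypeL)

theorem jMap_fst {N : ℕ} {p : ℝ≥0∞} [Fact (1 ≤ p)] {Ω Ω' : Set (Eucl N)} {hΩ : Ω ⊆ Ω'}
    {hb : Bornology.IsBounded Ω} (z : EnergySpace p hΩ hb) :
    (jMap p hΩ hb z).fst =ᵐ[leb Ω] fun x => uᵢ z x - uₑ z x :=
  z.2.2

theorem jMap_snd {N : ℕ} {p : ℝ≥0∞} [Fact (1 ≤ p)] {Ω Ω' : Set (Eucl N)} {hΩ : Ω ⊆ Ω'}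
    {hb : Bornology.IsBounded Ω} (z : EnergySpace p hΩ hb) :
    ((jMap p hΩ hb z).snd : Eucl N → ℝ) = wComp z :=
  rfl

/-- The integral of a real function in the extended reals, `∫ f⁺ - ∫ f⁻`. It takes the value `⊥`
as soon as `∫ f⁻ = ∞` (also if `∫ f⁺ = ∞`); otherwise it is the usual integral in `(-∞, +∞]`. -/
def extIntegral {α : Type*} [MeasurableSpace α] (μ : Measure α) (f : α → ℝ) : EReal :=
  ((∫⁻ x, ENNReal.ofReal (f x) ∂μ : ℝ≥0∞) : EReal) -
    ((∫⁻ x, ENNReal.ofReal (-f x) ∂μ : ℝ≥0∞) : EReal)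

section Energy

variable {N : ℕ} {p : ℝ≥0∞} [Fact (1 ≤ p)] {Ω Ω' : Set (Eucl N)} {hΩ : Ω ⊆ Ω'}
  {hb : Bornology.IsBounded Ω}

/-- `∫_Ω Q_i(x, ∇u_i)`. -/
def energyᵢ (Qᵢ : Eucl N → Eucl N → ℝ) (z : EnergySpace p hΩ hb) : EReal :=
  extIntegral (leb Ω) fun x => Qᵢ x (gradUᵢ z x)

/-- `∫_Ω' Q_e(x, ∇u_e)`. -/
def energyₑ (Qₑ : Eucl N → Eucl N → ℝ) (z : EnergySpace p hΩ hb) : EReal :=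
  extIntegral (leb Ω') fun x => Qₑ x (gradUₑ z x)

/-- `∫_Ω F(u_i - u_e, w)`. -/
def energyF (F : ℝ × ℝ → ℝ) (z : EnergySpace p hΩ hb) : EReal :=
  extIntegral (leb Ω) fun x => F (uᵢ z x - uₑ z x, wComp z x)

end Energy

/-- The bidomain energy. -/
def energy {N : ℕ} (p : ℝ≥0∞) [Fact (1 ≤ p)] {Ω Ω' : Set (Eucl N)} (hΩ : Ω ⊆ Ω')
    (hb : Bornology.IsBounded Ω) (Qᵢ Qₑ : Eucl N → Eucl N → ℝ) (F : ℝ × ℝ → ℝ)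
    (z : EnergySpace p hΩ hb) : EReal :=
  energyᵢ Qᵢ z + energyₑ Qₑ z + energyF F z

/-- The assumptions on `Q : Ω × ℝᴺ → ℝ`: (Lebesgue) measurable in the first variable,
differentiable and strictly convex in the second, `Q(x,0) = 0` and `Q(x,y) ≥ α |y|ᵖ`. -/
structure IsFluxPotential {N : ℕ} (p : ℝ≥0∞) (Ω : Set (Eucl N)) (Q : Eucl N → Eucl N → ℝ) :
    Prop where
  aemeasurable : ∀ y, AEMeasurable (fun x => Q x y) (leb Ω)
  differentiable : ∀ x ∈ Ω, Differentiable ℝ (Q x)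
  strictConvexOn : ∀ x ∈ Ω, StrictConvexOn ℝ Set.univ (Q x)
  map_zero : ∀ x ∈ Ω, Q x 0 = 0
  lower_bound : ∃ α > (0 : ℝ), ∀ x ∈ Ω, ∀ y, α * ‖y‖ ^ p.toReal ≤ Q x y

/-- `F : ℝ² → ℝ` is semiconvex. -/
def IsSemiconvex (F : ℝ × ℝ → ℝ) : Prop :=
  ∃ ω : ℝ, ConvexOn ℝ Set.univ fun z : ℝ × ℝ => F z + ω / 2 * (z.1 ^ 2 + z.2 ^ 2)

section Abstract

variable {V H : Type*} [NormedAddCommGroup V] [NormedSpace ℝ V]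
  [NormedAddCommGroup H] [InnerProductSpace ℝ H]

/-- The effective domain `{E < ∞}`. -/
def effDom (E : V → EReal) : Set V := {u | E u < ⊤}

/-- `E_ω = E + (ω/2) ‖j ·‖²`. -/
def shifted (E : V → EReal) (j : V →L[ℝ] H) (ω : ℝ) (u : V) : EReal :=
  E u + ((ω / 2 * ‖j u‖ ^ 2 : ℝ) : EReal)

/-- Convexity of a function with values in `ℝ ∪ {+∞}`. -/
def IsConvexFun (E : V → EReal) : Prop :=
  ∀ u v : V, ∀ a b : ℝ, 0 ≤ a → 0 ≤ b → a + b = 1 →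
    E (a • u + b • v) ≤ (a : EReal) * E u + (b : EReal) * E v

/-- Coercivity: all sublevel sets `{E ≤ c}` are relatively weakly compact. -/
def IsCoerciveFun (E : V → EReal) : Prop :=
  ∀ c : ℝ, IsCompact (closure (toWeakSpace ℝ V '' {u | E u ≤ (c : EReal)}))

/-- `j`-ellipticity: `E_ω` is convex and coercive for some real `ω`. -/
def IsJElliptic (E : V → EReal) (j : V →L[ℝ] H) : Prop :=
  ∃ ω : ℝ, IsConvexFun (shifted E j ω) ∧ IsCoerciveFun (shifted E j ω)

end Abstract

end Bidomain

end

/-!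
Adding `ω / 2 * |·|² + C` to `F` makes it convex and bounded below by `|·|²`; on the energy this
amounts to adding `ω / 2 * ‖j ·‖²` and a constant. What results is a sum of integrals of
nonnegative convex integrands, composed with continuous linear maps into `Lᵖ` spaces, hence convex,
and lower semicontinuous by Fatou's lemma. On a sublevel set the gradients are bounded in `Lᵖ` and
`(u_i - u_e, w)` is bounded in `L²`. Since `u_e` has mean zero over `Ω`, this controls the mean of
`u_i`, so that Poincaré's inequality bounds the whole sublevel set in `V`, and `V` is reflexive.
The energy is finite at `(φ, 0, ψ)` for test functions `φ` and `ψ`, whose images under `j` are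
dense in `H`.
-/

noncomputable section

namespace Bidomain

section Reflexive

/-- Reflexivity of a real normed space: the canonical map into the bidual is onto. It provides the
weak compactness of bounded sublevel sets. -/
def IsReflexiveSpace (E : Type*) [NormedAddCommGroup E] [NormedSpace ℝ E] : Prop :=
  Function.Surjective (NormedSpace.inclusionInDoubleDual ℝ E)

variable {E F : Type*} [NormedAddCommGroup E] [NormedSpace ℝ E]
  [NormedAddCommGroup F] [NormedSpace ℝ F]

theorem isReflexiveSpace_iff :
    IsReflexiveSpace E ↔ ∀ Φ : StrongDual ℝ (StrongDual ℝ E), ∃ x : E, ∀ f : StrongDual ℝ E,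
      Φ f = f x := by
  refine forall_congr' fun Φ => exists_congr fun x => ?_
  rw [ContinuousLinearMap.ext_iff]
  exact forall_congr' fun f => by rw [NormedSpace.dual_def, eq_comm]

theorem IsReflexiveSpace.isCompact_closure (hE : IsReflexiveSpace E) {S : Set E}
    (hS : Bornology.IsBounded S) : IsCompact (closure (toWeakSpace ℝ E '' S)) := by
  refine NormedSpace.isCompact_closure_of_isBounded ℝ E _ ?_ fun Φ _ => ?_
  · rwa [Set.preimage_image_eq _ (toWeakSpace ℝ E).injective]
  · obtain ⟨x, hx⟩ := hE (WeakDual.toStrongDual Φ)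
    exact ⟨toWeakSpace ℝ E x, WeakDual.toStrongDual.injective hx⟩

theorem IsReflexiveSpace.of_sum_comp_eq_id {ι : Type*} [Fintype ι] {F : ι → Type*}
    [∀ i, NormedAddCommGroup (F i)] [∀ i, NormedSpace ℝ (F i)] (hF : ∀ i, IsReflexiveSpace (F i))
    (T : ∀ i, E →L[ℝ] F i) (S : ∀ i, F i →L[ℝ] E) (h : ∑ i, S i ∘L T i = .id ℝ E) :
    IsReflexiveSpace E := by
  simp only [isReflexiveSpace_iff] at *
  intro Φ
  choose y hy using fun i => hF i (Φ ∘L (T i).precomp ℝ)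
  refine ⟨∑ i, S i (y i), fun f => ?_⟩
  calc Φ f = Φ (∑ i, (f ∘L S i) ∘L T i) := by
        simp_rw [ContinuousLinearMap.comp_assoc, ← ContinuousLinearMap.comp_finsetSum, h,
          ContinuousLinearMap.comp_id]
    _ = ∑ i, f (S i (y i)) := by
        rw [map_sum]
        exact Finset.sum_congr rfl fun i _ => hy i (f ∘L S i)
    _ = f (∑ i, S i (y i)) := (map_sum f _ _).symm

theorem IsReflexiveSpace.prod (hE : IsReflexiveSpace E) (hF : IsReflexiveSpace F) :
    IsReflexiveSpace (E × F) := by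
  rw [isReflexiveSpace_iff] at *
  intro Φ
  obtain ⟨x, hx⟩ := hE (Φ ∘L (ContinuousLinearMap.fst ℝ E F).precomp ℝ)
  obtain ⟨y, hy⟩ := hF (Φ ∘L (ContinuousLinearMap.snd ℝ E F).precomp ℝ)
  refine ⟨(x, y), fun f => ?_⟩
  have hf : f = (f ∘L .inl ℝ E F) ∘L .fst ℝ E F + (f ∘L .inr ℝ E F) ∘L .snd ℝ E F := by
    ext <;> simp [Prod.mk_zero_zero]
  calc Φ f = Φ ((f ∘L .inl ℝ E F) ∘L .fst ℝ E F) + Φ ((f ∘L .inr ℝ E F) ∘L .snd ℝ E F) := by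
        rw [← map_add, ← hf]
    _ = f (x, 0) + f (0, y) := congrArg₂ (· + ·) (hx _) (hy _)
    _ = f (x, y) := by rw [← map_add]; simp

theorem IsReflexiveSpace.submodule (hE : IsReflexiveSpace E) {S : Submodule ℝ E}
    (hS : IsClosed (S : Set E)) : IsReflexiveSpace S := by
  rw [isReflexiveSpace_iff] at *
  intro Φ
  obtain ⟨y, hy⟩ := hE (Φ ∘L S.subtypeL.precomp ℝ)
  have hyS : y ∈ S := by
    by_contra hne
    obtain ⟨f, hf⟩ := SeparatingDual.exists_ne_zero (R := ℝ)
      (mt (Submodule.Quotient.mk_eq_zero S).1 hne)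
    have hfS : (f ∘L S.mkQL) ∘L S.subtypeL = 0 := by
      ext w
      exact (congrArg f ((Submodule.Quotient.mk_eq_zero S).2 w.2)).trans (map_zero f)
    have h0 : (0 : ℝ) = f (S.mkQ y) := by simpa [hfS] using hy (f ∘L S.mkQL)
    exact hf h0.symm
  refine ⟨⟨y, hyS⟩, fun e => ?_⟩
  obtain ⟨f, hfe, -⟩ := exists_extension_norm_eq S e
  have hfS : f ∘L S.subtypeL = e := ContinuousLinearMap.ext hfe
  calc Φ e = Φ (f ∘L S.subtypeL) := by rw [hfS]
    _ = f y := hy f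
    _ = e ⟨y, hyS⟩ := hfe ⟨y, hyS⟩

end Reflexive

section LpDual

variable {α : Type*} [MeasurableSpace α] {μ : Measure α} {p q : ℝ≥0∞}

theorem integrable_simpleFunc_mul {g : α → ℝ} (hg : Integrable g μ) (f : SimpleFunc α ℝ) :
    Integrable (fun x => f x * g x) μ := by
  obtain ⟨C, hC⟩ := f.exists_forall_norm_le
  exact hg.bdd_mul f.aestronglyMeasurable (ae_of_all _ hC)

theorem exists_simpleFunc_sign {g : α → ℝ} (hg : Measurable g) :
    ∃ σ : SimpleFunc α ℝ, (∀ x, |σ x| = 1) ∧ ∀ x, σ x * g x = |g x| := by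
  refine ⟨SimpleFunc.piecewise {x | 0 ≤ g x} (measurableSet_le measurable_const hg)
    (SimpleFunc.const α 1) (SimpleFunc.const α (-1)), fun x => ?_, fun x => ?_⟩
  · by_cases hx : 0 ≤ g x <;> simp [hx]
  · by_cases hx : 0 ≤ g x
    · simp [hx, abs_of_nonneg]
    · simp [hx, abs_of_neg (not_le.1 hx)]

-- Since `t ≤ |g|^Q` can be close to `|g|^Q`, the function `f = sign g · t^{1/P}` is an approximate
-- extremizer of `f ↦ ∫ f g` on the spheres of `Lᴾ`.
theorem exists_simpleFunc_enorm_eq_rpow_and_le_mul {P Q : ℝ} (hPQ : P.HolderConjugate Q)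
    {g : α → ℝ} (hg : Measurable g) {t : SimpleFunc α NNReal} (ht : ∀ x, t x ≤ ‖g x‖ₑ ^ Q) :
    ∃ f : SimpleFunc α ℝ, (∀ x, ‖f x‖ₑ = (t x : ℝ≥0∞) ^ P⁻¹) ∧ (∀ x, 0 ≤ f x * g x) ∧
      ∀ x, (t x : ℝ≥0∞) ≤ ENNReal.ofReal (f x * g x) := by
  obtain ⟨σ, hσ, hσg⟩ := exists_simpleFunc_sign hg
  let f : SimpleFunc α ℝ := t.map (fun r : NNReal => (r : ℝ) ^ P⁻¹) * σ
  have hf (x) : f x = (t x : ℝ) ^ P⁻¹ * σ x := rfl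
  have hfg (x) : f x * g x = (t x : ℝ) ^ P⁻¹ * |g x| := by rw [hf, mul_assoc, hσg]
  have ht_root (x) : ENNReal.ofReal ((t x : ℝ) ^ P⁻¹) = (t x : ℝ≥0∞) ^ P⁻¹ := by
    rw [← ENNReal.ofReal_rpow_of_nonneg (NNReal.coe_nonneg _) (inv_nonneg.2 hPQ.nonneg),
      ENNReal.ofReal_coe_nnreal]
  refine ⟨f, fun x => ?_, fun x => ?_, fun x => ?_⟩
  · rw [hf, enorm_mul, ← ofReal_norm (σ x), Real.norm_eq_abs, hσ, ENNReal.ofReal_one, mul_one,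
      Real.enorm_of_nonneg (by positivity), ht_root]
  · rw [hfg]
    positivity
  · rw [hfg, ← Real.norm_eq_abs, ENNReal.ofReal_mul (by positivity), ofReal_norm, ht_root]
    calc (t x : ℝ≥0∞) = (t x : ℝ≥0∞) ^ P⁻¹ * (t x : ℝ≥0∞) ^ Q⁻¹ := by
          rw [← ENNReal.rpow_add_of_nonneg _ _ (inv_nonneg.2 hPQ.nonneg)
            (inv_nonneg.2 hPQ.symm.nonneg), hPQ.inv_add_inv_eq_one, ENNReal.rpow_one]
      _ ≤ (t x : ℝ≥0∞) ^ P⁻¹ * ‖g x‖ₑ := by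
          gcongr
          exact (ENNReal.rpow_inv_le_iff hPQ.symm.pos).2 (ht x)

theorem le_rpow_of_le_mul_rpow {P Q : ℝ} (hPQ : P.HolderConjugate Q) {I C : ℝ≥0∞} (hI : I ≠ ⊤)
    (h : I ≤ C * I ^ P⁻¹) : I ≤ C ^ Q := by
  rcases eq_or_ne I 0 with rfl | hI0
  · exact zero_le
  have hsplit : I = I ^ Q⁻¹ * I ^ P⁻¹ := by
    rw [← ENNReal.rpow_add _ _ hI0 hI, add_comm, hPQ.inv_add_inv_eq_one, ENNReal.rpow_one]
  have hroot : I ^ Q⁻¹ ≤ C := by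
    refine (ENNReal.mul_le_mul_iff_left (ENNReal.rpow_pos (pos_iff_ne_zero.2 hI0) hI).ne'
      (ENNReal.rpow_ne_top_of_nonneg (inv_nonneg.2 hPQ.nonneg) hI)).1 ?_
    rwa [← hsplit]
  calc I = (I ^ Q⁻¹) ^ Q := by
        rw [← ENNReal.rpow_mul, inv_mul_cancel₀ hPQ.symm.ne_zero, ENNReal.rpow_one]
    _ ≤ C ^ Q := ENNReal.rpow_le_rpow hroot hPQ.symm.nonneg

theorem lpPairing_mul_apply [Fact (1 ≤ p)] [Fact (1 ≤ q)] [q.HolderConjugate p] (g : Lp ℝ q μ)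
    (f : Lp ℝ p μ) :
    (ContinuousLinearMap.mul ℝ ℝ).lpPairing μ q p g f = ∫ x, g x * f x ∂μ :=
  ContinuousLinearMap.lpPairing_eq_integral _ g f

variable [IsFiniteMeasure μ]

theorem indicatorConstLp_biUnion_finset {ι E : Type*} [NormedAddCommGroup E] {A : ι → Set α}
    (hA : ∀ i, MeasurableSet (A i)) (hd : Pairwise (Function.onFun Disjoint A)) (c : E)
    (S : Finset ι) :
    indicatorConstLp p (S.measurableSet_biUnion fun i _ => hA i) (measure_ne_top μ _) c =
      ∑ i ∈ S, indicatorConstLp p (hA i) (measure_ne_top μ _) c := by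
  classical
  induction S using Finset.induction_on with
  | empty => simp
  | insert a S ha ih =>
    rw [Finset.sum_insert ha, ← ih, ← indicatorConstLp_disjoint_union]
    · congr 1
      simp
    · rw [Set.disjoint_iUnion₂_right]
      exact fun i hi => hd (by rintro rfl; exact ha hi)

theorem tendsto_measure_symmDiff_biUnion_finset {A : ℕ → Set α} (hA : ∀ i, MeasurableSet (A i))
    (hd : Pairwise (Function.onFun Disjoint A)) :
    Tendsto (fun S : Finset ℕ => μ (symmDiff (⋃ i ∈ S, A i) (⋃ i, A i))) atTop (𝓝 0) := by
  have hsum : ∑' i, μ (A i) ≠ ⊤ := by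
    rw [← measure_iUnion hd hA]
    exact measure_ne_top _ _
  refine tendsto_of_tendsto_of_tendsto_of_le_of_le tendsto_const_nhds
    (ENNReal.tendsto_tsum_compl_atTop_zero hsum) (fun _ => zero_le) fun S => ?_
  refine (measure_mono ?_).trans (measure_iUnion_le fun b : {x // x ∉ S} => A b)
  rintro x (⟨hx, hx'⟩ | ⟨hx, hx'⟩) <;> simp only [Set.mem_iUnion, not_exists] at hx hx' ⊢
  · obtain ⟨i, -, hi⟩ := hx
    exact absurd hi (hx' i)
  · obtain ⟨i, hi⟩ := hx
    exact ⟨⟨i, fun hiS => hx' i hiS hi⟩, hi⟩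

variable [Fact (1 ≤ p)]

theorem hasSum_indicatorConstLp (hp : p ≠ ⊤) {E : Type*} [NormedAddCommGroup E] {A : ℕ → Set α}
    (hA : ∀ i, MeasurableSet (A i)) (hd : Pairwise (Function.onFun Disjoint A)) (c : E) :
    HasSum (fun i => indicatorConstLp p (hA i) (measure_ne_top μ _) c)
      (indicatorConstLp p (MeasurableSet.iUnion hA) (measure_ne_top μ _) c) :=
  (tendsto_indicatorConstLp_set (hs := MeasurableSet.iUnion hA) (hμs := measure_ne_top _ _)
    (ht := fun S : Finset ℕ => S.measurableSet_biUnion fun i _ => hA i)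
    (hμt := fun _ => measure_ne_top _ _) hp
    (tendsto_measure_symmDiff_biUnion_finset hA hd)).congr
      (indicatorConstLp_biUnion_finset hA hd c)

/-- The signed measure `A ↦ φ(1_A)` defined by a functional `φ` on `Lᵖ`; its density represents
`φ`. -/
def dualSignedMeasure (hp : p ≠ ⊤) (φ : StrongDual ℝ (Lp ℝ p μ)) : SignedMeasure α where
  measureOf' A := by
    classical
    exact if hA : MeasurableSet A then φ (indicatorConstLp p hA (measure_ne_top μ _) 1) else 0
  empty' := by simp
  not_measurable' A hA := by simp [hA]
  m_iUnion' A hA hd := by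
    simpa only [hA, MeasurableSet.iUnion hA, dif_pos] using
      φ.hasSum (hasSum_indicatorConstLp hp hA hd 1)

theorem dualSignedMeasure_apply (hp : p ≠ ⊤) (φ : StrongDual ℝ (Lp ℝ p μ)) {A : Set α}
    (hA : MeasurableSet A) :
    dualSignedMeasure hp φ A = φ (indicatorConstLp p hA (measure_ne_top μ _) 1) := by
  classical
  exact dif_pos hA

theorem dualSignedMeasure_absolutelyContinuous (hp : p ≠ ⊤) (φ : StrongDual ℝ (Lp ℝ p μ)) :
    dualSignedMeasure hp φ ≪ᵥ μ.toENNRealVectorMeasure := by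
  refine VectorMeasure.AbsolutelyContinuous.mk fun A hA hA0 => ?_
  rw [Measure.toENNRealVectorMeasure_apply_measurable hA] at hA0
  have : indicatorConstLp p hA (measure_ne_top μ _) (1 : ℝ) = 0 :=
    (Lp.eq_zero_iff_ae_eq_zero).2 (indicatorConstLp_coeFn.trans (indicator_meas_zero hA0))
  rw [dualSignedMeasure_apply hp φ hA, this, map_zero]

theorem exists_integrable_dual_indicator (hp : p ≠ ⊤) (φ : StrongDual ℝ (Lp ℝ p μ)) :
    ∃ g : α → ℝ, Measurable g ∧ Integrable g μ ∧ ∀ (A : Set α) (hA : MeasurableSet A),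
      φ (indicatorConstLp p hA (measure_ne_top μ _) 1) = ∫ x in A, g x ∂μ := by
  have hg := SignedMeasure.integrable_rnDeriv (dualSignedMeasure hp φ) μ
  refine ⟨_, SignedMeasure.measurable_rnDeriv _ _, hg, fun A hA => ?_⟩
  rw [← dualSignedMeasure_apply hp, ← withDensityᵥ_apply hg hA,
    SignedMeasure.withDensityᵥ_rnDeriv_eq _ _ (dualSignedMeasure_absolutelyContinuous hp φ)]

theorem dual_apply_simpleFunc {φ : StrongDual ℝ (Lp ℝ p μ)} {g : α → ℝ} (hg : Integrable g μ)
    (h : ∀ (A : Set α) (hA : MeasurableSet A),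
      φ (indicatorConstLp p hA (measure_ne_top μ _) 1) = ∫ x in A, g x ∂μ) (f : SimpleFunc α ℝ) :
    φ ((f.memLp_of_isFiniteMeasure p μ).toLp f) = ∫ x, f x * g x ∂μ := by
  induction f using SimpleFunc.induction with
  | @const c A hA =>
    have htoLp : ((SimpleFunc.piecewise A hA (SimpleFunc.const α c)
        (SimpleFunc.const α 0)).memLp_of_isFiniteMeasure p μ).toLp _ =
        c • indicatorConstLp p hA (measure_ne_top μ _) (1 : ℝ) := by
      rw [indicatorConstLp, ← MemLp.toLp_const_smul, MemLp.toLp_eq_toLp_iff]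
      refine ae_of_all _ fun x => ?_
      by_cases hx : x ∈ A <;> simp [hx]
    rw [htoLp, map_smul, h A hA, ← integral_indicator hA, smul_eq_mul, ← integral_const_mul]
    congr 1
    ext x
    by_cases hx : x ∈ A <;> simp [hx]
  | @add f₁ f₂ _ h₁ h₂ =>
    have htoLp : ((f₁ + f₂).memLp_of_isFiniteMeasure p μ).toLp _ =
        (f₁.memLp_of_isFiniteMeasure p μ).toLp _ + (f₂.memLp_of_isFiniteMeasure p μ).toLp _ := by
      rw [← MemLp.toLp_add]
      rfl
    rw [htoLp, map_add, h₁, h₂,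
      ← integral_add (integrable_simpleFunc_mul hg _) (integrable_simpleFunc_mul hg _)]
    simp_rw [SimpleFunc.coe_add, Pi.add_apply, add_mul]

theorem lintegral_enorm_rpow_le_of_dual_apply {P Q : ℝ} (hPQ : P.HolderConjugate Q)
    (hP : p = ENNReal.ofReal P) {φ : StrongDual ℝ (Lp ℝ p μ)} {g : α → ℝ} (hgm : Measurable g)
    (hg : Integrable g μ)
    (h : ∀ f : SimpleFunc α ℝ, φ ((f.memLp_of_isFiniteMeasure p μ).toLp f) = ∫ x, f x * g x ∂μ) :
    ∫⁻ x, ‖g x‖ₑ ^ Q ∂μ ≤ ‖φ‖ₑ ^ Q := by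
  rw [lintegral_eq_nnreal]
  refine iSup₂_le fun t ht => ?_
  set I := (t.map ((↑) : NNReal → ℝ≥0∞)).lintegral μ
  have hI : I = ∫⁻ x, t x ∂μ := (SimpleFunc.lintegral_eq_lintegral _ μ).symm
  have hItop : I ≠ ⊤ := (SimpleFunc.FinMeasSupp.lintegral_lt_top
    (SimpleFunc.finMeasSupp_iff_support.2 (measure_lt_top _ _)) (ae_of_all _ (by simp))).ne
  obtain ⟨f, hf, hfg0, hfg⟩ := exists_simpleFunc_enorm_eq_rpow_and_le_mul hPQ hgm ht
  have hnorm : ‖(f.memLp_of_isFiniteMeasure p μ).toLp f‖ₑ = I ^ P⁻¹ := by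
    rw [Lp.enorm_toLp, hP, eLpNorm_eq_lintegral_rpow_enorm_toReal (by simpa using hPQ.pos)
      (by simp), ENNReal.toReal_ofReal hPQ.nonneg, one_div, hI]
    simp_rw [hf, ← ENNReal.rpow_mul, inv_mul_cancel₀ hPQ.ne_zero, ENNReal.rpow_one]
  refine le_rpow_of_le_mul_rpow hPQ hItop ?_
  calc I ≤ ∫⁻ x, ENNReal.ofReal (f x * g x) ∂μ := hI ▸ lintegral_mono hfg
    _ = ENNReal.ofReal (φ ((f.memLp_of_isFiniteMeasure p μ).toLp f)) := by
        rw [h, ofReal_integral_eq_lintegral_ofReal (integrable_simpleFunc_mul hg f)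
          (ae_of_all _ hfg0)]
    _ ≤ ‖φ ((f.memLp_of_isFiniteMeasure p μ).toLp f)‖ₑ := Real.ofReal_le_enorm _
    _ ≤ ‖φ‖ₑ * I ^ P⁻¹ := hnorm ▸ φ.le_opENorm _

variable [Fact (1 ≤ q)]

theorem lpPairing_mul_surjective [q.HolderConjugate p] (hp : p ≠ ⊤) (hq : q ≠ ⊤) :
    Function.Surjective ((ContinuousLinearMap.mul ℝ ℝ).lpPairing μ q p) := by
  intro φ
  have hPQ : p.toReal.HolderConjugate q.toReal :=
    (ENNReal.HolderConjugate.toReal_of_ne_top hq hp).symm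
  obtain ⟨g, hgm, hg, hgφ⟩ := exists_integrable_dual_indicator hp φ
  have hφ := dual_apply_simpleFunc hg hgφ
  have hgq : MemLp g q μ := by
    refine ⟨hgm.aestronglyMeasurable, ?_⟩
    rw [eLpNorm_lt_top_iff_lintegral_rpow_enorm_lt_top (zero_lt_one.trans_le Fact.out).ne' hq]
    exact (lintegral_enorm_rpow_le_of_dual_apply hPQ (ENNReal.ofReal_toReal hp).symm hgm hg
      hφ).trans_lt (ENNReal.rpow_lt_top_of_nonneg hPQ.symm.nonneg (by simp))
  refine ⟨hgq.toLp g, ContinuousLinearMap.ext fun f => ?_⟩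
  refine (Lp.simpleFunc.denseRange (p := p) (μ := μ) (E := ℝ) hp).induction_on f
    (isClosed_eq (ContinuousLinearMap.continuous _) φ.continuous) fun s => ?_
  rw [← Lp.simpleFunc.toLp_toSimpleFunc s]
  refine (lpPairing_mul_apply _ _).trans (Eq.trans ?_ (hφ (Lp.simpleFunc.toSimpleFunc s)).symm)
  refine integral_congr_ae ?_
  filter_upwards [hgq.coeFn_toLp, MemLp.coeFn_toLp (Lp.simpleFunc.memLp s)] with x hgx hsx
  rw [hgx, mul_comm]
  exact congrArg (· * g x) hsx

theorem isReflexiveSpace_Lp_real (hp₁ : 1 < p) (hp₂ : p ≠ ⊤) : IsReflexiveSpace (Lp ℝ p μ) := by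
  have hpq : p.HolderConjugate p.conjExponent := inferInstance
  have hqp : p.conjExponent.HolderConjugate p := hpq.symm
  have hq : p.conjExponent ≠ ⊤ := (ENNReal.HolderConjugate.ne_top_iff_ne_one _ p).2 hp₁.ne'
  have : Fact (1 ≤ p.conjExponent) := ⟨ENNReal.HolderConjugate.one_le _ p⟩
  rw [isReflexiveSpace_iff]
  intro Φ
  obtain ⟨f, hf⟩ := lpPairing_mul_surjective hq hp₂
    (Φ ∘L (ContinuousLinearMap.mul ℝ ℝ).lpPairing μ p.conjExponent p)
  refine ⟨f, fun φ => ?_⟩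
  obtain ⟨g, rfl⟩ := lpPairing_mul_surjective hp₂ hq φ
  calc Φ ((ContinuousLinearMap.mul ℝ ℝ).lpPairing μ p.conjExponent p g)
      = (ContinuousLinearMap.mul ℝ ℝ).lpPairing μ p p.conjExponent f g := by
        rw [hf]
        rfl
    _ = ∫ x, g x * f x ∂μ := by
        rw [lpPairing_mul_apply]
        simp_rw [mul_comm]
    _ = (ContinuousLinearMap.mul ℝ ℝ).lpPairing μ p.conjExponent p g f :=
        (lpPairing_mul_apply g f).symm

theorem isReflexiveSpace_Lp {E : Type*} [NormedAddCommGroup E] [NormedSpace ℝ E]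
    [FiniteDimensional ℝ E] (hp₁ : 1 < p) (hp₂ : p ≠ ⊤) : IsReflexiveSpace (Lp E p μ) := by
  let b := Module.finBasis ℝ E
  let T i : E →L[ℝ] ℝ := (b.coord i).toContinuousLinearMap
  let S i : ℝ →L[ℝ] E := ContinuousLinearMap.toSpanSingleton ℝ (b i)
  refine IsReflexiveSpace.of_sum_comp_eq_id (fun _ => isReflexiveSpace_Lp_real hp₁ hp₂)
    (fun i => (T i).compLpL p μ) (fun i => (S i).compLpL p μ) (ContinuousLinearMap.ext fun g => ?_)
  have hcoord : ∀ᵐ x ∂μ, ∀ i, (S i).compLp ((T i).compLp g) x = b.repr (g x) i • b i := by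
    refine ae_all_iff.2 fun i => ?_
    filter_upwards [(T i).coeFn_compLp g, (S i).coeFn_compLp ((T i).compLp g)] with x hT hS
    rw [hS, hT]
    rfl
  rw [sum_apply]
  refine Lp.ext ((Lp.coeFn_finsetSum _ _).trans ?_)
  filter_upwards [hcoord] with x hx
  rw [Finset.sum_apply]
  exact (Finset.sum_congr rfl fun i _ => hx i).trans (b.sum_repr (g x))

end LpDual

section Translation

variable {N : ℕ} {p : ℝ≥0∞} {Ω : Set (Eucl N)} {u u' : Eucl N → ℝ} {g g' : Eucl N → Eucl N}

theorem lintegral_rpow_le_of_isProbabilityMeasure {α : Type*} [MeasurableSpace α] {μ : Measure α}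
    [IsProbabilityMeasure μ] {P : ℝ} (hP : 1 ≤ P) {f : α → ℝ≥0∞} (hf : AEMeasurable f μ) :
    (∫⁻ x, f x ∂μ) ^ P ≤ ∫⁻ x, f x ^ P ∂μ := by
  have hP0 : 0 < P := by linarith
  have h := eLpNorm_le_eLpNorm_of_exponent_le (μ := μ) (p := 1) (q := ENNReal.ofReal P) (f := f)
    (by simpa using hP) hf.aestronglyMeasurable
  rw [eLpNorm_one_eq_lintegral_enorm, eLpNorm_eq_lintegral_rpow_enorm_toReal (by simpa using hP0)
    (by simp), ENNReal.toReal_ofReal hP0.le] at h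
  simp only [enorm_eq_self] at h
  calc _ ≤ ((∫⁻ x, f x ^ P ∂μ) ^ (1 / P)) ^ P := ENNReal.rpow_le_rpow h hP0.le
    _ = _ := by rw [← ENNReal.rpow_mul, one_div, inv_mul_cancel₀ hP0.ne', ENNReal.rpow_one]

theorem lintegral_rpow_average_translate_le {G β : Type*} [AddGroup G] [MeasurableSpace G]
    [MeasurableAdd₂ G] {μ : Measure G} [SFinite μ] [μ.IsAddRightInvariant] [MeasurableSpace β]
    {τ : Measure β} [IsProbabilityMeasure τ] {P : ℝ} (hP : 1 ≤ P) {k : G → ℝ≥0∞}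
    (hk : Measurable k) {T : β → G} (hT : Measurable T) :
    ∫⁻ x, (∫⁻ b, k (x + T b) ∂τ) ^ P ∂μ ≤ ∫⁻ x, k x ^ P ∂μ := by
  calc ∫⁻ x, (∫⁻ b, k (x + T b) ∂τ) ^ P ∂μ ≤ ∫⁻ x, ∫⁻ b, k (x + T b) ^ P ∂τ ∂μ :=
        lintegral_mono fun x => lintegral_rpow_le_of_isProbabilityMeasure hP
          (hk.comp (hT.const_add x)).aemeasurable
    _ = ∫⁻ b, ∫⁻ x, k (x + T b) ^ P ∂μ ∂τ :=
        lintegral_lintegral_swap ((hk.comp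
          (measurable_fst.add (hT.comp measurable_snd))).pow_const P).aemeasurable
    _ = ∫⁻ x, k x ^ P ∂μ := by
        simp only [lintegral_add_right_eq_self (fun x => k x ^ P), lintegral_const, measure_univ,
          mul_one]

theorem enorm_sub_le_lintegral_enorm_fderiv {E F : Type*} [NormedAddCommGroup E] [NormedSpace ℝ E]
    [NormedAddCommGroup F] [NormedSpace ℝ F] [CompleteSpace F] {f : E → F} (hf : ContDiff ℝ 1 f)
    (x h : E) :
    ‖f (x + h) - f x‖ₑ ≤ ∫⁻ t in Set.Icc (0 : ℝ) 1, ‖fderiv ℝ f (x + t • h) h‖ₑ := by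
  have hderiv : ∀ t : ℝ, HasDerivAt (fun t : ℝ => f (x + t • h)) (fderiv ℝ f (x + t • h) h) t := by
    refine fun t => ((hf.differentiable one_ne_zero _).hasFDerivAt).comp_hasDerivAt t ?_
    simpa using ((hasDerivAt_id t).smul_const h).const_add x
  have hcont : Continuous fun t : ℝ => fderiv ℝ f (x + t • h) h :=
    ((hf.continuous_fderiv one_ne_zero).comp (by fun_prop)).clm_apply continuous_const
  have hFTC := intervalIntegral.integral_eq_sub_of_hasDerivAt (a := 0) (b := 1)
    (fun t _ => hderiv t) (hcont.intervalIntegrable 0 1)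
  simp only [one_smul, zero_smul, add_zero] at hFTC
  rw [← hFTC, intervalIntegral.integral_of_le zero_le_one, ← integral_Icc_eq_integral_Ioc]
  exact enorm_integral_le_lintegral_enorm _

theorem IsWeakGradient.congr_ae (hw : IsWeakGradient Ω u g) (huu' : u =ᵐ[leb Ω] u')
    (hgg' : g =ᵐ[leb Ω] g') : IsWeakGradient Ω u' g' := by
  intro φ hφ hφc hφΩ y
  have hu := integral_congr_ae (huu'.mono fun x hx => congrArg (fderiv ℝ φ x y * ·) hx)
  have hg := integral_congr_ae (hgg'.mono fun x hx => congrArg (φ x * inner ℝ · y) hx)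
  exact hu.symm.trans ((hw φ hφ hφc hφΩ y).trans (congrArg Neg.neg hg))

/-- The mollification of (the extension by zero of) `u`. -/
def mollify (Ω : Set (Eucl N)) (ρ : ContDiffBump (0 : Eucl N)) (u : Eucl N → ℝ) : Eucl N → ℝ :=
  convolution (ρ.normed volume) (Ω.indicator u) (ContinuousLinearMap.lsmul ℝ ℝ) volume

/-- The probability measure whose density is the normalized bump `ρ`. -/
def bumpMeasure (ρ : ContDiffBump (0 : Eucl N)) : Measure (Eucl N) :=
  volume.withDensity fun z => ENNReal.ofReal (ρ.normed volume z)

instance (ρ : ContDiffBump (0 : Eucl N)) : IsProbabilityMeasure (bumpMeasure ρ) := by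
  refine ⟨?_⟩
  rw [bumpMeasure, withDensity_apply _ MeasurableSet.univ, Measure.restrict_univ,
    ← ofReal_integral_eq_lintegral_ofReal ρ.integrable_normed (ae_of_all _ ρ.nonneg_normed),
    ρ.integral_normed, ENNReal.ofReal_one]

theorem contDiff_mollify (hu : LocallyIntegrable (Ω.indicator u)) (ρ : ContDiffBump (0 : Eucl N)) :
    ContDiff ℝ 1 (mollify Ω ρ u) :=
  ρ.hasCompactSupport_normed.contDiff_convolution_left (n := 1) _ ρ.contDiff_normed hu

theorem tsupport_normed_const_sub_subset (ρ : ContDiffBump (0 : Eucl N)) (x : Eucl N) :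
    tsupport (fun y => ρ.normed volume (x - y)) ⊆ Metric.closedBall x ρ.rOut := by
  refine closure_minimal (fun y hy => ?_) Metric.isClosed_closedBall
  have hxy : x - y ∈ Function.support (ρ.normed volume) := hy
  rw [ρ.support_normed_eq, mem_ball_zero_iff] at hxy
  rw [Metric.mem_closedBall, dist_comm, dist_eq_norm]
  exact hxy.le

theorem fderiv_mollify (hΩ : MeasurableSet Ω) (hu : LocallyIntegrable (Ω.indicator u))
    (hw : IsWeakGradient Ω u g) (ρ : ContDiffBump (0 : Eucl N)) {x : Eucl N}
    (hx : Metric.closedBall x ρ.rOut ⊆ Ω) (h : Eucl N) :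
    fderiv ℝ (mollify Ω ρ u) x h = ∫ y in Ω, ρ.normed volume (x - y) * inner ℝ (g y) h := by
  have hρ : ContDiff ℝ 1 (ρ.normed (volume : Measure (Eucl N))) := ρ.contDiff_normed
  have hfderiv : ∀ y, fderiv ℝ (fun y => ρ.normed volume (x - y)) y h =
      - fderiv ℝ (ρ.normed volume) (x - y) h := fun y => by
    have hcomp : HasFDerivAt (fun y => ρ.normed volume (x - y)) _ y :=
      (hρ.differentiable one_ne_zero (x - y)).hasFDerivAt.comp y ((hasFDerivAt_id y).const_sub x)
    rw [hcomp.fderiv]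
    simp
  have hsupp := tsupport_normed_const_sub_subset ρ x
  have hweak := hw (fun y => ρ.normed volume (x - y))
    (ρ.contDiff_normed.comp (contDiff_const.sub contDiff_id))
    ((isCompact_closedBall x ρ.rOut).of_isClosed_subset (isClosed_tsupport _) hsupp)
    (hsupp.trans hx) h
  have hexists : ConvolutionExistsAt (fderiv ℝ (ρ.normed volume)) (Ω.indicator u) x
      (ContinuousLinearMap.precompL (Eucl N) (ContinuousLinearMap.lsmul ℝ ℝ)) volume :=
    (ρ.hasCompactSupport_normed.fderiv ℝ).convolutionExists_left _
      (hρ.continuous_fderiv one_ne_zero) hu x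
  rw [mollify, (ρ.hasCompactSupport_normed.hasFDerivAt_convolution_left _ hρ hu x).fderiv,
    convolution_def, ContinuousLinearMap.integral_apply hexists,
    ← integral_sub_left_eq_self _ volume x, ← neg_eq_iff_eq_neg.2 hweak, ← integral_neg,
    ← integral_indicator hΩ]
  refine integral_congr_ae (.of_forall fun y => ?_)
  by_cases hy : y ∈ Ω <;> simp [hy, hfderiv, ContinuousLinearMap.precompL_apply]

theorem enorm_fderiv_mollify_le (hΩ : MeasurableSet Ω) (hu : LocallyIntegrable (Ω.indicator u))
    (hg : Measurable g) (hw : IsWeakGradient Ω u g) (ρ : ContDiffBump (0 : Eucl N)) {x : Eucl N}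
    (hx : Metric.closedBall x ρ.rOut ⊆ Ω) (h : Eucl N) :
    ‖fderiv ℝ (mollify Ω ρ u) x h‖ₑ ≤
      ‖h‖ₑ * ∫⁻ z, Ω.indicator (fun y => ‖g y‖ₑ) (x - z) ∂bumpMeasure ρ := by
  have hk : Measurable (Ω.indicator fun y => ‖g y‖ₑ) := hg.enorm.indicator hΩ
  have hk' : Measurable fun z => Ω.indicator (fun y => ‖g y‖ₑ) (x - z) :=
    hk.comp (measurable_const_sub x)
  have hinner (y : Eucl N) : ‖inner ℝ (g y) h‖ₑ ≤ ‖h‖ₑ * ‖g y‖ₑ := by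
    rw [mul_comm]
    simpa only [ofReal_norm, ENNReal.ofReal_mul (norm_nonneg _)] using
      ENNReal.ofReal_le_ofReal (norm_inner_le_norm (𝕜 := ℝ) (g y) h)
  rw [fderiv_mollify hΩ hu hw ρ hx, bumpMeasure, lintegral_withDensity_eq_lintegral_mul _
    ρ.continuous_normed.measurable.ennreal_ofReal hk',
    ← lintegral_const_mul' _ _ enorm_ne_top,
    ← lintegral_sub_left_eq_self (μ := volume) (fun z => ‖h‖ₑ * _) x]
  refine (enorm_integral_le_lintegral_enorm _).trans ?_
  rw [← lintegral_indicator hΩ]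
  refine lintegral_mono fun y => ?_
  by_cases hy : y ∈ Ω
  · simp only [hy, Set.indicator_of_mem, Pi.mul_apply, sub_sub_cancel]
    rw [enorm_mul, Real.enorm_of_nonneg (ρ.nonneg_normed _), mul_left_comm]
    gcongr
    exact hinner y
  · simp [hy]

theorem lintegral_mollify_translate_sub_le (hΩ : MeasurableSet Ω)
    (hu : LocallyIntegrable (Ω.indicator u)) (hg : AEStronglyMeasurable g (leb Ω))
    (hw : IsWeakGradient Ω u g) {P : ℝ} (hP : 1 ≤ P) (ρ : ContDiffBump (0 : Eucl N))
    {h : Eucl N} {S : Set (Eucl N)} (hS : MeasurableSet S)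
    (hx : ∀ x ∈ S, ∀ t ∈ Set.Icc (0 : ℝ) 1, Metric.closedBall (x + t • h) ρ.rOut ⊆ Ω) :
    ∫⁻ x in S, ‖mollify Ω ρ u (x + h) - mollify Ω ρ u x‖ₑ ^ P ≤
      ‖h‖ₑ ^ P * ∫⁻ x in Ω, ‖g x‖ₑ ^ P := by
  wlog hgm : Measurable g generalizing g
  · have hg_mk : ∫⁻ x in Ω, ‖g x‖ₑ ^ P = ∫⁻ x in Ω, ‖hg.mk g x‖ₑ ^ P :=
      lintegral_congr_ae (hg.ae_eq_mk.fun_comp fun y => ‖y‖ₑ ^ P)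
    rw [hg_mk]
    exact this hg.stronglyMeasurable_mk.aestronglyMeasurable (hw.congr_ae ae_eq_rfl hg.ae_eq_mk)
      hg.stronglyMeasurable_mk.measurable
  have hP0 : 0 < P := by linarith
  have : IsProbabilityMeasure (volume.restrict (Set.Icc (0 : ℝ) 1)) := ⟨by simp⟩
  let k := Ω.indicator fun y => ‖g y‖ₑ
  have hk : Measurable k := hgm.enorm.indicator hΩ
  let τ := (volume.restrict (Set.Icc (0 : ℝ) 1)).prod (bumpMeasure ρ)
  have hpointwise : ∀ x ∈ S, ‖mollify Ω ρ u (x + h) - mollify Ω ρ u x‖ₑ ≤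
      ‖h‖ₑ * ∫⁻ q, k (x + (q.1 • h - q.2)) ∂τ := fun x hxS => by
    rw [lintegral_prod (fun q => k (x + (q.1 • h - q.2))) (hk.comp (by fun_prop)).aemeasurable,
      ← lintegral_const_mul' _ _ enorm_ne_top]
    refine (enorm_sub_le_lintegral_enorm_fderiv (contDiff_mollify hu ρ) x h).trans
      (setLIntegral_mono' measurableSet_Icc fun t ht => ?_)
    simpa only [add_sub_assoc] using enorm_fderiv_mollify_le hΩ hu hgm hw ρ (hx x hxS t ht) h
  calc ∫⁻ x in S, ‖mollify Ω ρ u (x + h) - mollify Ω ρ u x‖ₑ ^ P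
      ≤ ∫⁻ x in S, ‖h‖ₑ ^ P * (∫⁻ q, k (x + (q.1 • h - q.2)) ∂τ) ^ P :=
        setLIntegral_mono' hS fun x hxS => by
          rw [← ENNReal.mul_rpow_of_nonneg _ _ hP0.le]
          exact ENNReal.rpow_le_rpow (hpointwise x hxS) hP0.le
    _ ≤ ‖h‖ₑ ^ P * ∫⁻ x, (∫⁻ q, k (x + (q.1 • h - q.2)) ∂τ) ^ P := by
        rw [lintegral_const_mul' _ _ (ENNReal.rpow_ne_top_of_nonneg hP0.le enorm_ne_top)]
        gcongr
        exact Measure.restrict_le_self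
    _ ≤ ‖h‖ₑ ^ P * ∫⁻ x, k x ^ P := by
        gcongr ‖h‖ₑ ^ P * ?_
        exact lintegral_rpow_average_translate_le hP hk (μ := volume) (τ := τ)
          (T := fun q => q.1 • h - q.2) (by fun_prop)
    _ = ‖h‖ₑ ^ P * ∫⁻ x in Ω, ‖g x‖ₑ ^ P := by
        rw [← lintegral_indicator hΩ]
        congr 2 with x
        by_cases hxΩ : x ∈ Ω <;> simp [k, hxΩ, hP0]

theorem isOpen_setOf_closedBall_segment_subset (hΩ : IsOpen Ω) (h : Eucl N) (r : ℝ) :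
    IsOpen {x | ∀ t ∈ Set.Icc (0 : ℝ) 1, Metric.closedBall (x + t • h) r ⊆ Ω} := by
  have hK : IsCompact (Set.Icc (0 : ℝ) 1 ×ˢ Metric.closedBall (0 : Eucl N) r) :=
    isCompact_Icc.prod (isCompact_closedBall _ _)
  have heq : {x | ∀ t ∈ Set.Icc (0 : ℝ) 1, Metric.closedBall (x + t • h) r ⊆ Ω} =
      {x | ∀ q ∈ Set.Icc (0 : ℝ) 1 ×ˢ Metric.closedBall (0 : Eucl N) r,
        x + q.1 • h + q.2 ∈ Ω} := by
    ext x
    refine ⟨fun hx q hq => hx q.1 hq.1 ?_, fun hx t ht y hy => ?_⟩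
    · simpa only [Metric.mem_closedBall, dist_self_add_left, dist_zero_right] using hq.2
    · have hy' : y - (x + t • h) ∈ Metric.closedBall (0 : Eucl N) r := by
        rwa [mem_closedBall_zero_iff, ← dist_eq_norm]
      simpa only [add_sub_cancel] using hx (t, y - (x + t • h)) ⟨ht, hy'⟩
  rw [heq, isOpen_iff_eventually]
  refine fun x hx => hK.eventually_forall_of_forall_eventually fun q hq => ?_
  exact (hΩ.preimage (by fun_prop : Continuous fun z : Eucl N × (ℝ × Eucl N) =>
    z.1 + z.2.1 • h + z.2.2)).mem_nhds (hx q hq)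

theorem eventually_closedBall_segment_subset (hΩ : IsOpen Ω) {x h : Eucl N}
    (hx : ∀ t ∈ Set.Icc (0 : ℝ) 1, x + t • h ∈ Ω) :
    ∀ᶠ r in 𝓝 (0 : ℝ), ∀ t ∈ Set.Icc (0 : ℝ) 1, Metric.closedBall (x + t • h) r ⊆ Ω := by
  have hK : IsCompact ((fun t : ℝ => x + t • h) '' Set.Icc 0 1) :=
    isCompact_Icc.image (by fun_prop)
  obtain ⟨δ, hδ, hsub⟩ := hK.exists_cthickening_subset_open hΩ (Set.image_subset_iff.2 hx)
  filter_upwards [gt_mem_nhds hδ] with r hr t ht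
  have ht' : x + t • h ∈ (fun t : ℝ => x + t • h) '' Set.Icc 0 1 := ⟨t, ht, rfl⟩
  exact (Metric.closedBall_subset_closedBall hr.le).trans
    ((Metric.closedBall_subset_cthickening ht' δ).trans hsub)

theorem exists_mollify_tendsto (hu : LocallyIntegrable (Ω.indicator u)) :
    ∃ ρ : ℕ → ContDiffBump (0 : Eucl N), Tendsto (fun n => (ρ n).rOut) atTop (𝓝 0) ∧
      ∀ᵐ x, Tendsto (fun n => mollify Ω (ρ n) u x) atTop (𝓝 (Ω.indicator u x)) := by
  let ρ : ℕ → ContDiffBump (0 : Eucl N) := fun n =>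
    ⟨1 / (n + 1 : ℝ) / 2, 1 / (n + 1 : ℝ), by positivity, half_lt_self (by positivity)⟩
  have hρ : Tendsto (fun n => (ρ n).rOut) atTop (𝓝 0) := tendsto_one_div_add_atTop_nhds_zero_nat
  exact ⟨ρ, hρ, ContDiffBump.ae_convolution_tendsto_right_of_locallyIntegrable (K := 2) hρ
    (.of_forall fun n => by simp only [ρ]; linarith) hu⟩

theorem lintegral_translate_sub_le (hΩ : IsOpen Ω) (hp : 1 ≤ p) (hu : MemLp u p (leb Ω))
    (hg : AEStronglyMeasurable g (leb Ω)) (hw : IsWeakGradient Ω u g) {P : ℝ} (hP : 1 ≤ P)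
    {h : Eucl N} {A : Set (Eucl N)} (hA : MeasurableSet A)
    (hAh : ∀ x ∈ A, ∀ t ∈ Set.Icc (0 : ℝ) 1, x + t • h ∈ Ω) :
    ∫⁻ x in A, ‖u (x + h) - u x‖ₑ ^ P ≤ ‖h‖ₑ ^ P * ∫⁻ x in Ω, ‖g x‖ₑ ^ P := by
  have hloc : LocallyIntegrable (Ω.indicator u) :=
    ((memLp_indicator_iff_restrict hΩ.measurableSet).2 hu).locallyIntegrable hp
  obtain ⟨ρ, hρ, hlim⟩ := exists_mollify_tendsto hloc
  have hlim_add := (measurePreserving_add_right volume h).quasiMeasurePreserving.ae hlim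
  let S : ℕ → Set (Eucl N) := fun n =>
    {x | ∀ t ∈ Set.Icc (0 : ℝ) 1, Metric.closedBall (x + t • h) (ρ n).rOut ⊆ Ω}
  have hS : ∀ n, MeasurableSet (S n) := fun n =>
    (isOpen_setOf_closedBall_segment_subset hΩ h _).measurableSet
  let D : ℕ → Eucl N → ℝ≥0∞ := fun n x =>
    ‖mollify Ω (ρ n) u (x + h) - mollify Ω (ρ n) u x‖ₑ ^ P
  have hD : ∀ n, Measurable (D n) := fun n => by
    have := (contDiff_mollify hloc (ρ n)).continuous
    fun_prop
  have hD_le : ∀ n, ∫⁻ x in A, (S n).indicator (D n) x ≤ ‖h‖ₑ ^ P * ∫⁻ x in Ω, ‖g x‖ₑ ^ P :=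
    fun n => (setLIntegral_le_lintegral _ _).trans <| (lintegral_indicator (hS n) _).trans_le <|
      lintegral_mollify_translate_sub_le hΩ.measurableSet hloc hg hw hP (ρ n) (hS n)
        fun _ hx => hx
  have hD_lim : ∀ᵐ x ∂volume.restrict A,
      Tendsto (fun n => (S n).indicator (D n) x) atTop (𝓝 (‖u (x + h) - u x‖ₑ ^ P)) := by
    filter_upwards [ae_restrict_of_ae hlim, ae_restrict_of_ae hlim_add, ae_restrict_mem hA]
      with x hx hxh hxA
    rw [Set.indicator_of_mem (by simpa using hAh x hxA 0 (by simp))] at hx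
    rw [Set.indicator_of_mem (by simpa using hAh x hxA 1 (by simp))] at hxh
    refine ((ENNReal.continuous_rpow_const.tendsto _).comp
      ((continuous_enorm.tendsto _).comp (hxh.sub hx))).congr' ?_
    filter_upwards [hρ.eventually (eventually_closedBall_segment_subset hΩ (hAh x hxA))] with n hn
    exact (Set.indicator_of_mem (show x ∈ S n from hn) (D n)).symm
  calc ∫⁻ x in A, ‖u (x + h) - u x‖ₑ ^ P
      = ∫⁻ x in A, liminf (fun n => (S n).indicator (D n) x) atTop :=
        lintegral_congr_ae (hD_lim.mono fun _ hx => hx.liminf_eq.symm)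
    _ ≤ liminf (fun n => ∫⁻ x in A, (S n).indicator (D n) x) atTop :=
        lintegral_liminf_le fun n => (hD n).indicator (hS n)
    _ ≤ ‖h‖ₑ ^ P * ∫⁻ x in Ω, ‖g x‖ₑ ^ P :=
        liminf_le_of_frequently_le' (.of_forall hD_le)

end Translation

section Poincare

variable {N : ℕ} {p : ℝ≥0∞} {Ω U V A : Set (Eucl N)}

/-- Near each boundary point, `Ω` is the region strictly above the graph of a continuous function,
in an orthonormal coordinate system; this is `HasC1Boundary` without differentiability. -/
def HasContinuousBoundary (Ω : Set (Eucl N)) : Prop :=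
  ∀ x₀ ∈ frontier Ω, ∃ r > (0 : ℝ), ∃ e : Eucl N, ‖e‖ = 1 ∧
    ∃ γ : (Submodule.span ℝ {e})ᗮ → ℝ, Continuous γ ∧
      ∀ x ∈ Metric.ball x₀ r,
        x ∈ Ω ↔ γ ((Submodule.span ℝ {e})ᗮ.orthogonalProjectionOnto x) < inner ℝ e x

theorem HasC1Boundary.hasContinuousBoundary (hΩ : HasC1Boundary Ω) : HasContinuousBoundary Ω := by
  intro x₀ hx₀
  obtain ⟨r, hr, e, he, γ, hγ, hΩγ⟩ := hΩ x₀ hx₀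
  exact ⟨r, hr, e, he, γ, hγ.continuous, hΩγ⟩

/-- A bounded domain (nonempty, open, connected) with continuous boundary. -/
structure IsContinuousDomain (Ω : Set (Eucl N)) : Prop where
  isOpen : IsOpen Ω
  isConnected : IsConnected Ω
  isBounded : Bornology.IsBounded Ω
  hasContinuousBoundary : HasContinuousBoundary Ω

theorem IsC1Domain.isContinuousDomain (hΩ : IsC1Domain Ω) : IsContinuousDomain Ω :=
  ⟨hΩ.isOpen, hΩ.isConnected, hΩ.isBounded, hΩ.hasC1Boundary.hasContinuousBoundary⟩

/-- On `U ⊆ Ω`, Sobolev functions on `Ω` are constant up to an error controlled by the gradient.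
Only everywhere measurable representatives `u` are considered, so that `u` may be translated. -/
def IsPoincareSet (p : ℝ≥0∞) (Ω U : Set (Eucl N)) : Prop :=
  ∃ C : ℝ≥0∞, C ≠ ⊤ ∧ ∀ (u : Eucl N → ℝ) (g : Eucl N → Eucl N), Measurable u →
    MemLp u p (leb Ω) → AEStronglyMeasurable g (leb Ω) → IsWeakGradient Ω u g →
      ∃ c : ℝ, eLpNorm (fun x => u x - c) p (leb U) ≤ C * eLpNorm g p (leb Ω)

theorem eLpNorm_translate_sub_le (hΩ : IsOpen Ω) (hp : 1 ≤ p) (hp' : p ≠ ⊤) {u : Eucl N → ℝ}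
    {g : Eucl N → Eucl N} (hu : MemLp u p (leb Ω)) (hg : AEStronglyMeasurable g (leb Ω))
    (hw : IsWeakGradient Ω u g) {h : Eucl N} (hA : MeasurableSet A)
    (hAh : ∀ x ∈ A, ∀ t ∈ Set.Icc (0 : ℝ) 1, x + t • h ∈ Ω) :
    eLpNorm (fun x => u (x + h) - u x) p (leb A) ≤ ‖h‖ₑ * eLpNorm g p (leb Ω) := by
  have hp0 : p ≠ 0 := (zero_lt_one.trans_le hp).ne'
  have hP : 1 ≤ p.toReal := by simpa using ENNReal.toReal_mono hp' hp
  have hP0 : 0 < p.toReal := by linarith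
  simp only [eLpNorm_eq_lintegral_rpow_enorm_toReal hp0 hp']
  calc (∫⁻ x in A, ‖u (x + h) - u x‖ₑ ^ p.toReal) ^ (1 / p.toReal)
      ≤ (‖h‖ₑ ^ p.toReal * ∫⁻ x in Ω, ‖g x‖ₑ ^ p.toReal) ^ (1 / p.toReal) :=
        ENNReal.rpow_le_rpow (lintegral_translate_sub_le hΩ hp hu hg hw hP hA hAh) (by positivity)
    _ = ‖h‖ₑ * (∫⁻ x in Ω, ‖g x‖ₑ ^ p.toReal) ^ (1 / p.toReal) := by
        rw [ENNReal.mul_rpow_of_nonneg _ _ (by positivity), ← ENNReal.rpow_mul, mul_one_div,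
          div_self hP0.ne', ENNReal.rpow_one]

theorem IsPoincareSet.of_translate (hΩ : IsOpen Ω) (hp : 1 ≤ p) (hp' : p ≠ ⊤)
    (hU : IsPoincareSet p Ω U) (hUm : MeasurableSet U) {h : Eucl N} (hA : MeasurableSet A)
    (hAh : ∀ x ∈ A, ∀ t ∈ Set.Icc (0 : ℝ) 1, x + t • h ∈ Ω) (hAU : ∀ x ∈ A, x + h ∈ U) :
    IsPoincareSet p Ω A := by
  obtain ⟨C, hC, hCU⟩ := hU
  refine ⟨C + ‖h‖ₑ, by simp [hC], fun u g hum hu hg hw => ?_⟩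
  obtain ⟨c, hc⟩ := hCU u g hum hu hg hw
  have hum' : Measurable fun x => u (x + h) := hum.comp (measurable_add_const h)
  have htranslate : eLpNorm (fun x => u (x + h) - c) p (leb A) ≤
      eLpNorm (fun x => u x - c) p (leb U) := by
    rw [← eLpNorm_comp_measurePreserving (hum.sub_const c).aestronglyMeasurable
      ((measurePreserving_add_right volume h).restrict_preimage hUm)]
    exact eLpNorm_mono_measure _ (Measure.restrict_mono hAU le_rfl)
  refine ⟨c, ?_⟩
  calc eLpNorm (fun x => u x - c) p (leb A)
      = eLpNorm ((fun x => u (x + h) - c) - fun x => u (x + h) - u x) p (leb A) := by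
        congr 1 with x
        simp
    _ ≤ eLpNorm (fun x => u (x + h) - c) p (leb A) +
        eLpNorm (fun x => u (x + h) - u x) p (leb A) :=
        eLpNorm_sub_le (hum'.sub_const c).aestronglyMeasurable
          (hum'.sub hum).aestronglyMeasurable hp
    _ ≤ C * eLpNorm g p (leb Ω) + ‖h‖ₑ * eLpNorm g p (leb Ω) :=
        add_le_add (htranslate.trans hc) (eLpNorm_translate_sub_le hΩ hp hp' hu hg hw hA hAh)
    _ = (C + ‖h‖ₑ) * eLpNorm g p (leb Ω) := (add_mul _ _ _).symm

theorem add_smul_mem_ball {E : Type*} [SeminormedAddCommGroup E] [NormedSpace ℝ E] {x₀ x h : E}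
    {r s t : ℝ} (hx : x ∈ Metric.ball x₀ r) (hh : ‖h‖ ≤ s) (ht : t ∈ Set.Icc (0 : ℝ) 1) :
    x + t • h ∈ Metric.ball x₀ (r + s) := by
  have hth : ‖t • h‖ ≤ 1 * ‖h‖ := by
    rw [norm_smul, Real.norm_of_nonneg ht.1]
    gcongr
    exact ht.2
  calc dist (x + t • h) x₀ ≤ dist (x + t • h) x + dist x x₀ := dist_triangle _ _ _
    _ < r + s := by
      rw [dist_self_add_left]
      linarith [Metric.mem_ball.1 hx]

theorem lintegral_lintegral_ball_le {E : Type*} [NormedAddCommGroup E] [MeasurableSpace E]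
    [OpensMeasurableSpace E] [MeasurableAdd₂ E] {μ : Measure E} [SFinite μ] [μ.IsAddLeftInvariant]
    {f : E → E → ℝ≥0∞} (hf : Measurable (Function.uncurry f)) (x₀ : E) (r : ℝ) :
    ∫⁻ y in Metric.ball x₀ r, ∫⁻ x in Metric.ball x₀ r, f y x ∂μ ∂μ ≤
      ∫⁻ h in Metric.ball 0 (2 * r), ∫⁻ y in Metric.ball x₀ r, f y (y + h) ∂μ ∂μ := by
  have hf' : Measurable (Function.uncurry fun y h => f y (y + h)) :=
    hf.comp (measurable_fst.prodMk (measurable_fst.add measurable_snd))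
  rw [← lintegral_lintegral_swap hf'.aemeasurable]
  refine setLIntegral_mono' measurableSet_ball fun y hy => ?_
  rw [← lintegral_indicator measurableSet_ball, ← lintegral_indicator measurableSet_ball,
    ← lintegral_add_left_eq_self _ y]
  refine lintegral_mono fun h => ?_
  by_cases hyh : y + h ∈ Metric.ball x₀ r
  · have hh : h ∈ Metric.ball (0 : E) (2 * r) := by
      have hdist : dist (y + h) y = ‖h‖ := by simp
      rw [mem_ball_zero_iff, ← hdist]
      linarith [dist_triangle_right (y + h) y x₀, Metric.mem_ball.1 hy, Metric.mem_ball.1 hyh]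
    rw [Set.indicator_of_mem hyh, Set.indicator_of_mem hh]
  · rw [Set.indicator_of_notMem hyh]
    exact zero_le

theorem isPoincareSet_ball (hΩ : IsOpen Ω) (hp : 1 ≤ p) (hp' : p ≠ ⊤) {x₀ : Eucl N} {r : ℝ}
    (hr : 0 < r) (hB : Metric.ball x₀ (3 * r) ⊆ Ω) : IsPoincareSet p Ω (Metric.ball x₀ r) := by
  have hp0 : p ≠ 0 := (zero_lt_one.trans_le hp).ne'
  have hP : 1 ≤ p.toReal := by simpa using ENNReal.toReal_mono hp' hp
  let B := Metric.ball x₀ r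
  let D := Metric.ball (0 : Eucl N) (2 * r)
  let K := ENNReal.ofReal (2 * r) ^ p.toReal * volume D
  have hB0 : volume B ≠ 0 := (Metric.measure_ball_pos _ _ hr).ne'
  have hK : K ≠ ⊤ := ENNReal.mul_ne_top
    (ENNReal.rpow_ne_top_of_nonneg (by positivity) ENNReal.ofReal_ne_top) measure_ball_lt_top.ne
  refine ⟨(K / volume B) ^ (1 / p.toReal), ENNReal.rpow_ne_top_of_nonneg (by positivity)
    (ENNReal.div_ne_top hK hB0), fun u g hum hu hg hw => ?_⟩
  have hu_sub : Measurable fun q : Eucl N × Eucl N => ‖u q.2 - u q.1‖ₑ ^ p.toReal := by fun_prop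
  have htranslate : ∀ h ∈ D, ∫⁻ x in B, ‖u (x + h) - u x‖ₑ ^ p.toReal ≤
      ENNReal.ofReal (2 * r) ^ p.toReal * ∫⁻ x in Ω, ‖g x‖ₑ ^ p.toReal := by
    intro h hh
    rw [mem_ball_zero_iff] at hh
    refine (lintegral_translate_sub_le hΩ hp hu hg hw hP measurableSet_ball fun x hx t ht =>
      hB ?_).trans ?_
    · rw [show 3 * r = r + 2 * r by ring]
      exact add_smul_mem_ball hx hh.le ht
    · rw [← ofReal_norm]
      gcongr
  have hdouble : ∫⁻ y in B, ∫⁻ x in B, ‖u x - u y‖ₑ ^ p.toReal ≤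
      K * ∫⁻ x in Ω, ‖g x‖ₑ ^ p.toReal := by
    refine (lintegral_lintegral_ball_le hu_sub x₀ r).trans
      ((setLIntegral_mono' measurableSet_ball htranslate).trans_eq ?_)
    rw [setLIntegral_const]
    ring
  obtain ⟨y, -, hy⟩ := exists_le_setLAverage (μ := volume)
    (f := fun y => ∫⁻ x in B, ‖u x - u y‖ₑ ^ p.toReal) hB0 measure_ball_lt_top.ne
    (Measurable.lintegral_prod_right' hu_sub).aemeasurable
  refine ⟨u y, ?_⟩
  rw [setLAverage_eq] at hy
  rw [eLpNorm_eq_lintegral_rpow_enorm_toReal hp0 hp',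
    eLpNorm_eq_lintegral_rpow_enorm_toReal hp0 hp',
    ← ENNReal.mul_rpow_of_nonneg _ _ (by positivity), ← ENNReal.mul_div_right_comm]
  exact ENNReal.rpow_le_rpow (hy.trans (ENNReal.div_le_div_right hdouble _)) (by positivity)

theorem eLpNorm_union_le {α : Type*} [MeasurableSpace α] {μ : Measure α} {E : Type*}
    [NormedAddCommGroup E] (hp : 1 ≤ p) (hp' : p ≠ ⊤) (f : α → E) (U V : Set α) :
    eLpNorm f p (μ.restrict (U ∪ V)) ≤ eLpNorm f p (μ.restrict U) + eLpNorm f p (μ.restrict V) := by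
  have hp0 : p ≠ 0 := (zero_lt_one.trans_le hp).ne'
  have hP : 1 ≤ p.toReal := by simpa using ENNReal.toReal_mono hp' hp
  simp only [eLpNorm_eq_lintegral_rpow_enorm_toReal hp0 hp']
  refine (ENNReal.rpow_le_rpow (lintegral_union_le _ U V) (by positivity)).trans ?_
  exact ENNReal.rpow_add_le_add_rpow _ _ (by positivity) (div_le_one_of_le₀ hP (by linarith))

theorem enorm_sub_mul_measure_rpow_le {α E : Type*} [MeasurableSpace α] [NormedAddCommGroup E]
    {μ : Measure α} (hp : 1 ≤ p) (hp' : p ≠ ⊤) {f : α → E} (hf : AEStronglyMeasurable f μ)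
    (b c : E) :
    ‖b - c‖ₑ * μ Set.univ ^ (1 / p.toReal) ≤
      eLpNorm (fun x => f x - c) p μ + eLpNorm (fun x => f x - b) p μ := by
  rw [← eLpNorm_const' _ (zero_lt_one.trans_le hp).ne' hp']
  refine le_trans (le_of_eq ?_) (eLpNorm_sub_le (hf.sub aestronglyMeasurable_const)
    (hf.sub aestronglyMeasurable_const) hp)
  congr 1 with x
  simp

theorem eLpNorm_sub_const_le {α E : Type*} [MeasurableSpace α] [NormedAddCommGroup E]
    {μ : Measure α} (hp : 1 ≤ p) (hp' : p ≠ ⊤) {f : α → E} (hf : AEStronglyMeasurable f μ)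
    (b c : E) :
    eLpNorm (fun x => f x - c) p μ ≤
      eLpNorm (fun x => f x - b) p μ + ‖b - c‖ₑ * μ Set.univ ^ (1 / p.toReal) := by
  rw [← eLpNorm_const' _ (zero_lt_one.trans_le hp).ne' hp']
  refine le_trans (le_of_eq ?_) (eLpNorm_add_le (hf.sub aestronglyMeasurable_const)
    aestronglyMeasurable_const hp)
  congr 1 with x
  simp

theorem IsPoincareSet.union (hp : 1 ≤ p) (hp' : p ≠ ⊤) (hU : IsPoincareSet p Ω U)
    (hV : IsPoincareSet p Ω V) (hUV : volume (U ∩ V) ≠ 0) (hVt : volume V ≠ ⊤) :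
    IsPoincareSet p Ω (U ∪ V) := by
  obtain ⟨C, hC, hCU⟩ := hU
  obtain ⟨K, hK, hKV⟩ := hV
  let m := volume (U ∩ V) ^ (1 / p.toReal)
  let M := volume V ^ (1 / p.toReal)
  have hUVt : volume (U ∩ V) ≠ ⊤ := measure_ne_top_of_subset Set.inter_subset_right hVt
  have hm0 : m ≠ 0 := (ENNReal.rpow_pos (pos_iff_ne_zero.2 hUV) hUVt).ne'
  have hmt : m ≠ ⊤ := ENNReal.rpow_ne_top_of_nonneg (by positivity) hUVt
  have hMt : M ≠ ⊤ := ENNReal.rpow_ne_top_of_nonneg (by positivity) hVt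
  refine ⟨C + (K + (C + K) / m * M), ?_, fun u g hum hu hg hw => ?_⟩
  · simp [hC, hK, ENNReal.mul_eq_top, hMt, ENNReal.div_eq_top, hm0, hmt]
  obtain ⟨c, hc⟩ := hCU u g hum hu hg hw
  obtain ⟨k, hk⟩ := hKV u g hum hu hg hw
  let G := eLpNorm g p (leb Ω)
  have hconst : ‖k - c‖ₑ ≤ (C + K) / m * G := by
    rw [← ENNReal.mul_div_right_comm, ENNReal.le_div_iff_mul_le (.inl hm0) (.inl hmt), add_mul]
    have hle := enorm_sub_mul_measure_rpow_le (μ := leb (U ∩ V)) hp hp'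
      hum.aestronglyMeasurable k c
    rw [Measure.restrict_apply_univ] at hle
    exact hle.trans (add_le_add
      ((eLpNorm_mono_measure _ (Measure.restrict_mono Set.inter_subset_left le_rfl)).trans hc)
      ((eLpNorm_mono_measure _ (Measure.restrict_mono Set.inter_subset_right le_rfl)).trans hk))
  refine ⟨c, (eLpNorm_union_le hp hp' _ U V).trans ?_⟩
  calc eLpNorm (fun x => u x - c) p (leb U) + eLpNorm (fun x => u x - c) p (leb V)
      ≤ C * G + (K * G + (C + K) / m * G * M) := by
        have hle := eLpNorm_sub_const_le (μ := leb V) hp hp' hum.aestronglyMeasurable k c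
        rw [Measure.restrict_apply_univ] at hle
        exact add_le_add hc (hle.trans (add_le_add hk (mul_le_mul_left hconst M)))
    _ = (C + (K + (C + K) / m * M)) * G := by ring

theorem induction_on_finset_open_cover {X ι : Type*} [TopologicalSpace X] {P : Set X → Prop}
    {T : Finset ι} {V : ι → Set X} {S : Set X} (hS : IsConnected S)
    (hV : ∀ i ∈ T, IsOpen (V i)) (hTS : ⋃ i ∈ T, V i = S) (hP : ∀ i ∈ T, P (V i))
    (hunion : ∀ U, IsOpen U → P U → ∀ i ∈ T, (U ∩ V i).Nonempty → P (U ∪ V i)) : P S := by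
  classical
  obtain ⟨x, hx⟩ := hS.nonempty
  obtain ⟨i₀, hi₀, hx₀⟩ := Set.mem_iUnion₂.1 (hTS.superset hx)
  let good : Finset ι → Prop := fun R => R ⊆ T ∧ i₀ ∈ R ∧ P (⋃ i ∈ R, V i)
  have hfin : {R | good R}.Finite := T.powerset.finite_toSet.subset fun R hR => by
    simpa using hR.1
  obtain ⟨R, ⟨hRT, hi₀R, hRP⟩, hmax⟩ := hfin.exists_maximal
    ⟨{i₀}, by simpa using hi₀, by simp, by simpa using hP i₀ hi₀⟩
  have hopen : IsOpen (⋃ i ∈ R, V i) := isOpen_biUnion fun i hi => hV i (hRT hi)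
  have hR : ∀ i ∈ T \ R, ¬ ((⋃ i ∈ R, V i) ∩ V i).Nonempty := by
    intro i hi hne
    obtain ⟨hiT, hiR⟩ := Finset.mem_sdiff.1 hi
    have hgood : good (insert i R) := by
      refine ⟨Finset.insert_subset hiT hRT, Finset.mem_insert_of_mem hi₀R, ?_⟩
      rw [Finset.set_biUnion_insert, Set.union_comm]
      exact hunion _ hopen hRP i hiT hne
    exact hiR (hmax hgood (Finset.subset_insert _ _) (Finset.mem_insert_self _ _))
  have hcover : S ⊆ (⋃ i ∈ R, V i) ∪ ⋃ i ∈ T \ R, V i := by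
    rw [← Finset.set_biUnion_union, Finset.union_sdiff_of_subset hRT, hTS]
  have hdisjoint : Disjoint (⋃ i ∈ R, V i) (⋃ i ∈ T \ R, V i) := by
    simp only [Set.disjoint_iUnion_right]
    exact fun i hi => Set.not_nonempty_iff_eq_empty.1 (hR i hi) |>.le |> Set.disjoint_iff.2
  have hsubset : S ⊆ ⋃ i ∈ R, V i := hS.isPreconnected.subset_left_of_subset_union hopen
    (isOpen_biUnion fun i hi => hV i (Finset.mem_sdiff.1 hi).1) hdisjoint hcover
    ⟨x, hx, Set.mem_iUnion₂.2 ⟨i₀, hi₀R, hx₀⟩⟩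
  rwa [hsubset.antisymm (hTS ▸ Set.biUnion_subset_biUnion_left hRT)]

theorem isPoincareSet_of_locally (hp : 1 ≤ p) (hp' : p ≠ ⊤) (hΩ : IsOpen Ω) (hconn : IsConnected Ω)
    (hb : Bornology.IsBounded Ω)
    (hloc : ∀ x ∈ closure Ω, ∃ W, IsOpen W ∧ x ∈ W ∧ IsPoincareSet p Ω (W ∩ Ω)) :
    IsPoincareSet p Ω Ω := by
  choose! W hWo hxW hWP using hloc
  obtain ⟨T, hTcl, hTcov⟩ := hb.isCompact_closure.elim_nhds_subcover W
    fun x hx => (hWo x hx).mem_nhds (hxW x hx)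
  have hopen : ∀ x ∈ T, IsOpen (W x ∩ Ω) := fun x hx => (hWo x (hTcl x hx)).inter hΩ
  have hcover : ⋃ x ∈ T, W x ∩ Ω = Ω := by
    rw [← Set.iUnion₂_inter]
    exact Set.inter_eq_right.2 (subset_closure.trans hTcov)
  refine induction_on_finset_open_cover hconn hopen hcover (fun x hx => hWP x (hTcl x hx))
    fun U hUo hU x hx hne => hU.union hp hp' (hWP x (hTcl x hx)) ?_ ?_
  · exact (hUo.inter (hopen x hx)).measure_ne_zero volume hne
  · exact measure_ne_top_of_subset Set.inter_subset_right hb.measure_lt_top.ne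

-- Near a boundary point, moving a fixed distance up the graph direction pushes `Ω` into itself.
theorem HasContinuousBoundary.exists_translate (hΩ : IsOpen Ω) (hΩγ : HasContinuousBoundary Ω)
    {x₀ : Eucl N} (hx₀ : x₀ ∈ frontier Ω) :
    ∃ (h : Eucl N) (δ : ℝ), 0 < δ ∧ Metric.ball (x₀ + h) (3 * δ) ⊆ Ω ∧
      ∀ x ∈ Metric.ball x₀ δ ∩ Ω, ∀ t ∈ Set.Icc (0 : ℝ) 1, x + t • h ∈ Ω := by
  obtain ⟨r, hr, e, he, γ, hγ, hiff⟩ := hΩγ x₀ hx₀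
  let π := (Submodule.span ℝ {e})ᗮ.orthogonalProjectionOnto
  have hπ : ∀ (x : Eucl N) (s : ℝ), π (x + s • e) = π x := fun x s => by
    have hπe : π e = 0 :=
      Submodule.orthogonalProjectionOnto_orthogonalComplement_singleton_eq_zero e
    rw [map_add, map_smul, hπe, smul_zero, add_zero]
  have hinner : ∀ (x : Eucl N) (s : ℝ), inner ℝ e (x + s • e) = inner ℝ e x + s := fun x s => by
    rw [inner_add_right, inner_smul_right, real_inner_self_eq_norm_sq, he]
    ring
  have hx₀γ : γ (π x₀) ≤ inner ℝ e x₀ := by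
    by_contra! hlt
    have hbelow : IsOpen {x | inner ℝ e x < γ (π x)} :=
      isOpen_lt (by fun_prop) (hγ.comp π.continuous)
    obtain ⟨y, ⟨hy, hyr⟩, hyΩ⟩ := mem_closure_iff.1 (frontier_subset_closure hx₀) _
      (hbelow.inter Metric.isOpen_ball) ⟨hlt, Metric.mem_ball_self hr⟩
    exact lt_asymm hy ((hiff y hyr).1 hyΩ)
  let h : Eucl N := (r / 2) • e
  have hnorm : ‖h‖ = r / 2 := by
    rw [norm_smul, he, mul_one, Real.norm_of_nonneg (by positivity)]
  have hx₀h : x₀ + h ∈ Ω := by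
    rw [hiff _ (by simpa [hnorm] using hr)]
    change γ (π (x₀ + (r / 2) • e)) < inner ℝ e (x₀ + (r / 2) • e)
    rw [hπ, hinner]
    linarith
  obtain ⟨η, hη, hηΩ⟩ := Metric.isOpen_iff.1 hΩ _ hx₀h
  have hη_le := min_le_left (η / 3) (r / 2)
  refine ⟨h, min (η / 3) (r / 2), by positivity,
    (Metric.ball_subset_ball (by linarith)).trans hηΩ, fun x ⟨hxb, hxΩ⟩ t ht => ?_⟩
  have hxb' := Metric.ball_subset_ball (min_le_right (η / 3) (r / 2)) hxb
  have hxγ := (hiff x (Metric.ball_subset_ball (by linarith) hxb')).1 hxΩ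
  rw [hiff _ (by simpa using add_smul_mem_ball hxb' hnorm.le ht)]
  change γ (π (x + t • (r / 2) • e)) < inner ℝ e (x + t • (r / 2) • e)
  rw [smul_smul, hπ, hinner]
  have := mul_nonneg ht.1 (half_pos hr).le
  linarith

theorem IsContinuousDomain.isPoincareSet (hp : 1 ≤ p) (hp' : p ≠ ⊤) (hΩ : IsContinuousDomain Ω) :
    IsPoincareSet p Ω Ω := by
  refine isPoincareSet_of_locally hp hp' hΩ.isOpen hΩ.isConnected hΩ.isBounded fun x hx => ?_
  by_cases hxΩ : x ∈ Ω
  · obtain ⟨η, hη, hηΩ⟩ := Metric.isOpen_iff.1 hΩ.isOpen _ hxΩ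
    have hball : Metric.ball x (3 * (η / 3)) ⊆ Ω := by
      rwa [mul_div_cancel₀ _ (by norm_num : (3 : ℝ) ≠ 0)]
    refine ⟨Metric.ball x (η / 3), Metric.isOpen_ball, Metric.mem_ball_self (by positivity), ?_⟩
    rw [Set.inter_eq_left.2 ((Metric.ball_subset_ball (by linarith)).trans hball)]
    exact isPoincareSet_ball hΩ.isOpen hp hp' (by positivity) hball
  · have hxf : x ∈ frontier Ω := by
      rw [hΩ.isOpen.frontier_eq]
      exact ⟨hx, hxΩ⟩
    obtain ⟨h, δ, hδ, hball, hsegment⟩ := hΩ.hasContinuousBoundary.exists_translate hΩ.isOpen hxf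
    refine ⟨Metric.ball x δ, Metric.isOpen_ball, Metric.mem_ball_self hδ, ?_⟩
    refine (isPoincareSet_ball hΩ.isOpen hp hp' hδ hball).of_translate hΩ.isOpen hp hp'
      measurableSet_ball (measurableSet_ball.inter hΩ.isOpen.measurableSet) hsegment fun y hy => ?_
    simpa only [Metric.mem_ball, dist_add_right] using hy.1

end Poincare

section PoincareMean

variable {N : ℕ} {p : ℝ≥0∞} {Ω A : Set (Eucl N)}

theorem exists_clm_eq_integral_mul {α : Type*} [MeasurableSpace α] {μ : Measure α} {q : ℝ≥0∞}
    [Fact (1 ≤ p)] [Fact (1 ≤ q)] [q.HolderConjugate p] {f : α → ℝ} (hf : MemLp f q μ) :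
    ∃ ℓ : Lp ℝ p μ →L[ℝ] ℝ, ∀ u, ℓ u = ∫ x, f x * u x ∂μ := by
  refine ⟨(ContinuousLinearMap.mul ℝ ℝ).lpPairing μ q p (hf.toLp f), fun u => ?_⟩
  rw [lpPairing_mul_apply]
  refine integral_congr_ae ?_
  filter_upwards [hf.coeFn_toLp] with x hx
  rw [hx]

theorem exists_clm_eq_setIntegral {α : Type*} [MeasurableSpace α] {μ : Measure α} {s t : Set α}
    [IsFiniteMeasure (μ.restrict t)] [Fact (1 ≤ p)] (hs : MeasurableSet s) (hst : s ⊆ t) :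
    ∃ ℓ : Lp ℝ p (μ.restrict t) →L[ℝ] ℝ, ∀ u, ℓ u = ∫ x in s, u x ∂μ := by
  have hq : Fact (1 ≤ p.conjExponent) := ⟨by simp [ENNReal.conjExponent]⟩
  have : p.conjExponent.HolderConjugate p := ENNReal.HolderConjugate.symm
  obtain ⟨ℓ, hℓ⟩ := exists_clm_eq_integral_mul (p := p)
    (memLp_indicator_const p.conjExponent hs (1 : ℝ) (Or.inr (measure_ne_top (μ.restrict t) s)))
  refine ⟨ℓ, fun u => ?_⟩
  have hrestrict : (μ.restrict t).restrict s = μ.restrict s := by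
    rw [Measure.restrict_restrict hs, Set.inter_eq_left.2 hst]
  rw [hℓ, ← hrestrict, ← integral_indicator hs]
  congr 1 with x
  by_cases hx : x ∈ s <;> simp [hx]

theorem isFiniteMeasure_leb (hΩ : Bornology.IsBounded Ω) : IsFiniteMeasure (leb Ω) :=
  ⟨by simpa using hΩ.measure_lt_top⟩

-- `u ↦ u - (ℓ u / ℓ e) • e` is a bounded projection that does not distinguish `u` from `u - c • e`.
theorem exists_norm_le_norm_sub_smul_add {E : Type*} [NormedAddCommGroup E] [NormedSpace ℝ E]
    (ℓ : E →L[ℝ] ℝ) {e : E} (he : ℓ e ≠ 0) :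
    ∃ C : ℝ, 0 ≤ C ∧ ∀ u (c : ℝ), ‖u‖ ≤ C * (‖u - c • e‖ + |ℓ u|) := by
  let P : E →L[ℝ] E := .id ℝ E - ((ℓ e)⁻¹ • ℓ).smulRight e
  have hP (u : E) (c : ℝ) : u = P (u - c • e) + (ℓ u / ℓ e) • e := by
    have hPe : P e = 0 := by simp [P, he]
    have hPu : P u = u - (ℓ u / ℓ e) • e := by simp [P, div_eq_inv_mul]
    rw [map_sub, map_smul, hPe, hPu]
    simp
  refine ⟨‖P‖ + ‖e‖ / |ℓ e|, by positivity, fun u c => ?_⟩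
  calc ‖u‖ ≤ ‖P (u - c • e)‖ + ‖(ℓ u / ℓ e) • e‖ := by
        conv_lhs => rw [hP u c]
        exact norm_add_le _ _
    _ ≤ ‖P‖ * ‖u - c • e‖ + ‖e‖ / |ℓ e| * |ℓ u| := by
        refine add_le_add (P.le_opNorm _) (le_of_eq ?_)
        rw [norm_smul, Real.norm_eq_abs, abs_div]
        ring
    _ ≤ (‖P‖ + ‖e‖ / |ℓ e|) * (‖u - c • e‖ + |ℓ u|) := by
        have h1 : 0 ≤ ‖P‖ * |ℓ u| := by positivity
        have h2 : 0 ≤ ‖e‖ / |ℓ e| * ‖u - c • e‖ := by positivity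
        linarith

variable [Fact (1 ≤ p)] [IsFiniteMeasure (leb Ω)]

theorem IsPoincareSet.exists_norm_sub_smul_const_le (hΩ : IsPoincareSet p Ω Ω) :
    ∃ C : ℝ, 0 ≤ C ∧ ∀ z : Sobolev p Ω,
      ∃ c : ℝ, ‖z.1.1 - c • Lp.const p (leb Ω) (1 : ℝ)‖ ≤ C * ‖z.1.2‖ := by
  obtain ⟨C, hC, hP⟩ := hΩ
  refine ⟨C.toReal, ENNReal.toReal_nonneg, fun z => ?_⟩
  have hum := Lp.aestronglyMeasurable z.1.1
  have hw : IsWeakGradient Ω (hum.mk _) z.1.2 := z.2.congr_ae hum.ae_eq_mk ae_eq_rfl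
  obtain ⟨c, hc⟩ := hP (hum.mk _) z.1.2 hum.stronglyMeasurable_mk.measurable
    ((Lp.memLp z.1.1).ae_eq hum.ae_eq_mk) (Lp.aestronglyMeasurable _) hw
  refine ⟨c, ?_⟩
  rw [Lp.norm_def, Lp.norm_def, ← ENNReal.toReal_mul]
  refine ENNReal.toReal_mono (ENNReal.mul_ne_top hC (Lp.eLpNorm_ne_top _))
    (hc.trans_eq' (eLpNorm_congr_ae ?_))
  filter_upwards [Lp.coeFn_sub z.1.1 (c • Lp.const p (leb Ω) (1 : ℝ)),
    Lp.coeFn_smul c (Lp.const p (leb Ω) (1 : ℝ)), Lp.coeFn_const p (leb Ω) (1 : ℝ), hum.ae_eq_mk]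
    with x hsub hsmul hconst hmk
  rw [hsub, Pi.sub_apply, hsmul, Pi.smul_apply, hconst, hmk]
  simp

theorem IsPoincareSet.exists_norm_le (hΩ : IsPoincareSet p Ω Ω) (hA : MeasurableSet A)
    (hAΩ : A ⊆ Ω) (hA0 : volume A ≠ 0) :
    ∃ C : ℝ, 0 ≤ C ∧ ∀ z : Sobolev p Ω, ‖z.1.1‖ ≤ C * (‖z.1.2‖ + |∫ x in A, z.1.1 x|) := by
  obtain ⟨K, hK0, hK⟩ := hΩ.exists_norm_sub_smul_const_le
  obtain ⟨ℓ, hℓ⟩ := exists_clm_eq_setIntegral (p := p) (μ := volume) hA hAΩ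
  have hℓ1 : ℓ (Lp.const p (leb Ω) (1 : ℝ)) ≠ 0 := by
    have hA_top : volume A ≠ ⊤ := by
      rw [← Measure.restrict_eq_self volume hAΩ]
      exact measure_ne_top (leb Ω) A
    rw [hℓ, integral_congr_ae (ae_mono (Measure.restrict_mono hAΩ le_rfl) (Lp.coeFn_const _ _ _))]
    simpa using (measureReal_ne_zero_iff hA_top).2 hA0
  obtain ⟨C, hC0, hC⟩ := exists_norm_le_norm_sub_smul_add ℓ hℓ1
  refine ⟨C * (K + 1), by positivity, fun z => ?_⟩
  obtain ⟨c, hc⟩ := hK z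
  calc ‖z.1.1‖ ≤ C * (‖z.1.1 - c • Lp.const p (leb Ω) (1 : ℝ)‖ + |ℓ z.1.1|) := hC _ c
    _ ≤ C * (K * ‖z.1.2‖ + |ℓ z.1.1|) := by gcongr
    _ ≤ C * ((K + 1) * (‖z.1.2‖ + |ℓ z.1.1|)) := by
        have h : 0 ≤ K * |ℓ z.1.1| := by positivity
        gcongr
        linarith [norm_nonneg z.1.2]
    _ = C * (K + 1) * (‖z.1.2‖ + |∫ x in A, z.1.1 x|) := by rw [hℓ]; ring

end PoincareMean

section EnergySpaceReflexive

variable {N : ℕ} {p : ℝ≥0∞} [Fact (1 ≤ p)] {Ω Ω' : Set (Eucl N)}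

theorem continuous_integral_testFunction_mul {f : Eucl N → ℝ} (hf : Continuous f)
    (hf' : HasCompactSupport f) :
    Continuous fun u : Lp ℝ p (leb Ω) => ∫ x in Ω, f x * u x := by
  have hq : Fact (1 ≤ p.conjExponent) := ⟨by simp [ENNReal.conjExponent]⟩
  have : p.conjExponent.HolderConjugate p := ENNReal.HolderConjugate.symm
  obtain ⟨ℓ, hℓ⟩ := exists_clm_eq_integral_mul (p := p)
    (hf.memLp_of_hasCompactSupport (p := p.conjExponent) (μ := leb Ω) hf')
  simp_rw [← hℓ]
  exact ℓ.continuous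

theorem isClosed_sobolev :
    IsClosed (Sobolev p Ω : Set (Lp ℝ p (leb Ω) × Lp (Eucl N) p (leb Ω))) := by
  change IsClosed {z : Lp ℝ p (leb Ω) × Lp (Eucl N) p (leb Ω) | IsWeakGradient Ω z.1 z.2}
  simp only [IsWeakGradient, Set.ofPred_forall]
  refine isClosed_iInter fun φ => isClosed_iInter fun hφ => isClosed_iInter fun hφc =>
    isClosed_iInter fun _ => isClosed_iInter fun y => ?_
  have hgrad (g : Lp (Eucl N) p (leb Ω)) : ∫ x in Ω, φ x * inner ℝ (g x) y =
      ∫ x in Ω, φ x * (innerSL ℝ y).compLpL p (leb Ω) g x := by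
    refine integral_congr_ae ?_
    filter_upwards [ContinuousLinearMap.coeFn_compLpL (innerSL ℝ y) g] with x hx
    rw [hx, innerSL_apply_apply, real_inner_comm]
  simp_rw [hgrad]
  exact isClosed_eq
    ((continuous_integral_testFunction_mul
      ((hφ.continuous_fderiv (by simp)).clm_apply continuous_const)
      (hφc.fderiv_apply ℝ y)).comp continuous_fst)
    ((continuous_integral_testFunction_mul hφ.continuous hφc).comp
      (((innerSL ℝ y).compLpL p (leb Ω)).continuous.comp continuous_snd)).neg

theorem ae_eq_sub_iff_forall_setIntegral_eq {α : Type*} [MeasurableSpace α] {μ : Measure α}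
    {s : Set α} (hs : MeasurableSet s) {f g h : α → ℝ} (hf : IntegrableOn f s μ)
    (hg : IntegrableOn g s μ) (hh : IntegrableOn h s μ) :
    (f =ᵐ[μ.restrict s] fun x => g x - h x) ↔ ∀ t, MeasurableSet t → t ⊆ s →
      ∫ x in t, f x ∂μ = ∫ x in t, g x ∂μ - ∫ x in t, h x ∂μ := by
  refine ⟨fun hfgh t _ hts => ?_, fun hfgh => ?_⟩
  · rw [← integral_sub (hg.mono_set hts) (hh.mono_set hts)]
    exact integral_congr_ae (ae_mono (Measure.restrict_mono hts le_rfl) hfgh)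
  · refine Integrable.ae_eq_of_forall_setIntegral_eq _ _ hf (hg.sub hh) fun t ht _ => ?_
    have hts : t ∩ s ⊆ s := Set.inter_subset_right
    rw [Measure.restrict_restrict ht, integral_sub (hg.mono_set hts) (hh.mono_set hts)]
    exact hfgh _ (ht.inter hs) hts

theorem isClosed_energySpace (hΩ : MeasurableSet Ω) (hsub : Ω ⊆ Ω') (hb : Bornology.IsBounded Ω)
    (hb' : Bornology.IsBounded Ω') :
    IsClosed (EnergySpace p hsub hb : Set (Sobolev p Ω × Sobolev p Ω' × Lp ℝ 2 (leb Ω) ×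
      Lp ℝ 2 (leb Ω))) := by
  have := isFiniteMeasure_leb hb
  have := isFiniteMeasure_leb hb'
  have hp : 1 ≤ p := Fact.out
  have hchar : (EnergySpace p hsub hb : Set (Sobolev p Ω × Sobolev p Ω' × Lp ℝ 2 (leb Ω) ×
      Lp ℝ 2 (leb Ω))) = {z | ∫ x in Ω, z.2.1.1.1 x = 0} ∩ {z | ∀ A, MeasurableSet A → A ⊆ Ω →
        ∫ x in A, z.2.2.2 x = (∫ x in A, z.1.1.1 x) - ∫ x in A, z.2.1.1.1 x} := by
    ext z
    exact and_congr_right fun _ => ae_eq_sub_iff_forall_setIntegral_eq hΩ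
      ((Lp.memLp z.2.2.2).integrable (by norm_num)) ((Lp.memLp z.1.1.1).integrable hp)
      (integrable_restrict hp hsub hb _)
  rw [hchar]
  refine IsClosed.inter ?_ ?_
  · obtain ⟨ℓ, hℓ⟩ := exists_clm_eq_setIntegral (p := p) (μ := volume) hΩ hsub
    simp_rw [← hℓ]
    exact isClosed_eq (by fun_prop) continuous_const
  · simp only [Set.ofPred_forall]
    refine isClosed_iInter fun A => isClosed_iInter fun hA => isClosed_iInter fun hAΩ => ?_
    obtain ⟨ℓᵥ, hᵥ⟩ := exists_clm_eq_setIntegral (p := 2) (μ := volume) hA hAΩ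
    obtain ⟨ℓᵢ, hᵢ⟩ := exists_clm_eq_setIntegral (p := p) (μ := volume) hA hAΩ
    obtain ⟨ℓₑ, hₑ⟩ := exists_clm_eq_setIntegral (p := p) (μ := volume) hA (hAΩ.trans hsub)
    simp_rw [← hᵥ, ← hᵢ, ← hₑ]
    exact isClosed_eq (by fun_prop) (by fun_prop)

theorem isReflexiveSpace_energySpace (hp : 1 < p) (hp' : p ≠ ⊤) (hΩ : MeasurableSet Ω)
    (hsub : Ω ⊆ Ω') (hb : Bornology.IsBounded Ω) (hb' : Bornology.IsBounded Ω') :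
    IsReflexiveSpace (EnergySpace p hsub hb) := by
  have hSobolev {U : Set (Eucl N)} (hU : Bornology.IsBounded U) :
      IsReflexiveSpace (Sobolev p U) := by
    have := isFiniteMeasure_leb hU
    exact ((isReflexiveSpace_Lp hp hp').prod (isReflexiveSpace_Lp hp hp')).submodule
      isClosed_sobolev
  have := isFiniteMeasure_leb hb
  have hL2 : IsReflexiveSpace (Lp ℝ 2 (leb Ω)) := isReflexiveSpace_Lp (by norm_num) (by norm_num)
  exact ((hSobolev hb).prod ((hSobolev hb').prod (hL2.prod hL2))).submodule
    (isClosed_energySpace hΩ hsub hb hb')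

end EnergySpaceReflexive

section ConvexIntegrand

open scoped NNReal

variable {α E : Type*} [MeasurableSpace α] {μ : Measure α} {Φ : α → E → ℝ}

/-- The integral functional `g ↦ ∫ Φ(x, g x) dμ`, with values in `[0, ∞]`; the negative part of
`Φ` is discarded. -/
def integralFunctional (μ : Measure α) (Φ : α → E → ℝ) (g : α → E) : ℝ≥0∞ :=
  ∫⁻ x, ENNReal.ofReal (Φ x (g x)) ∂μ

theorem integralFunctional_congr {f g : α → E} (h : f =ᵐ[μ] g) :
    integralFunctional μ Φ f = integralFunctional μ Φ g :=
  lintegral_congr_ae (h.mono fun x hx => by simp only [hx])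

theorem aemeasurable_comp_simpleFunc (hΦ : ∀ y, AEMeasurable (fun x => Φ x y) μ)
    (s : SimpleFunc α E) : AEMeasurable (fun x => Φ x (s x)) μ := by
  classical
  have hsum : (fun x => Φ x (s x)) = ∑ y ∈ s.range, (s ⁻¹' {y}).indicator (fun x => Φ x y) := by
    ext x
    rw [Finset.sum_apply, Finset.sum_eq_single_of_mem (s x) (s.mem_range_self x)]
    · simp
    · exact fun y _ hy => Set.indicator_of_notMem (fun h => hy (Eq.symm h)) _
  rw [hsum]
  exact Finset.aemeasurable_sum _ fun y _ => (hΦ y).indicator (s.measurableSet_fiber y)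

theorem aemeasurable_comp_of_continuous [TopologicalSpace E]
    (hΦ : ∀ y, AEMeasurable (fun x => Φ x y) μ) (hΦc : ∀ᵐ x ∂μ, Continuous (Φ x)) {g : α → E}
    (hg : AEStronglyMeasurable g μ) : AEMeasurable (fun x => Φ x (g x)) μ := by
  refine aemeasurable_of_tendsto_metrizable_ae atTop
    (fun n => aemeasurable_comp_simpleFunc hΦ (hg.stronglyMeasurable_mk.approx n)) ?_
  filter_upwards [hΦc, hg.ae_eq_mk] with x hx hgx
  rw [hgx]
  exact (hx.tendsto _).comp (hg.stronglyMeasurable_mk.tendsto_approx x)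

variable [NormedAddCommGroup E] {p : ℝ≥0∞}

theorem isBounded_setOf_integralFunctional_le [Fact (1 ≤ p)] (hp : p ≠ ⊤) {c : ℝ} (hc : 0 < c)
    (hΦ : ∀ᵐ x ∂μ, ∀ y, c * ‖y‖ ^ p.toReal ≤ Φ x y) (M : ℝ≥0) :
    Bornology.IsBounded {g : Lp E p μ | integralFunctional μ Φ g ≤ M} := by
  have hp0 : p ≠ 0 := (zero_lt_one.trans_le Fact.out).ne'
  have hp' : 0 < p.toReal := ENNReal.toReal_pos hp0 hp
  refine isBounded_iff_forall_norm_le.2 ⟨(M / c) ^ p.toReal⁻¹, fun g hg => ?_⟩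
  have hnorm : ENNReal.ofReal (c * ‖g‖ ^ p.toReal) =
      ∫⁻ x, ENNReal.ofReal (c * ‖g x‖ ^ p.toReal) ∂μ := by
    simp only [ENNReal.ofReal_mul hc.le, ← ENNReal.ofReal_rpow_of_nonneg (norm_nonneg _) hp'.le,
      ofReal_norm]
    rw [lintegral_const_mul' _ _ ENNReal.ofReal_ne_top, Lp.enorm_def,
      eLpNorm_eq_lintegral_rpow_enorm_toReal hp0 hp, ← ENNReal.rpow_mul, one_div,
      inv_mul_cancel₀ hp'.ne', ENNReal.rpow_one]
  have hle : ENNReal.ofReal (c * ‖g‖ ^ p.toReal) ≤ ENNReal.ofReal M := by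
    rw [hnorm, ENNReal.ofReal_coe_nnreal]
    exact (lintegral_mono_ae (hΦ.mono fun x hx => ENNReal.ofReal_le_ofReal (hx _))).trans hg
  rw [ENNReal.ofReal_le_ofReal_iff M.coe_nonneg] at hle
  rwa [Real.le_rpow_inv_iff_of_pos (norm_nonneg _) (by positivity) hp', le_div_iff₀' hc]

variable [NormedSpace ℝ E]

/-- A nonnegative convex integrand: measurable in the first variable and, for almost every value
of it, nonnegative and convex in the second. -/
structure IsConvexIntegrand (μ : Measure α) (Φ : α → E → ℝ) : Prop where
  aemeasurable : ∀ y, AEMeasurable (fun x => Φ x y) μ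
  convexOn : ∀ᵐ x ∂μ, ConvexOn ℝ Set.univ (Φ x)
  nonneg : ∀ᵐ x ∂μ, ∀ y, 0 ≤ Φ x y

theorem isConvexIntegrand_const {G : E → ℝ} (hG : ConvexOn ℝ Set.univ G) (hG0 : ∀ y, 0 ≤ G y) :
    IsConvexIntegrand μ fun _ => G where
  aemeasurable _ := aemeasurable_const
  convexOn := ae_of_all _ fun _ => hG
  nonneg := ae_of_all _ fun _ => hG0

namespace IsConvexIntegrand

variable [FiniteDimensional ℝ E]

theorem continuous (hΦ : IsConvexIntegrand μ Φ) : ∀ᵐ x ∂μ, Continuous (Φ x) :=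
  hΦ.convexOn.mono fun _ hx => hx.locallyLipschitz.continuous

theorem aemeasurable_comp (hΦ : IsConvexIntegrand μ Φ) {g : α → E}
    (hg : AEStronglyMeasurable g μ) : AEMeasurable (fun x => Φ x (g x)) μ :=
  aemeasurable_comp_of_continuous hΦ.aemeasurable hΦ.continuous hg

theorem convexOn_integralFunctional (hΦ : IsConvexIntegrand μ Φ) :
    ConvexOn ℝ≥0 Set.univ fun g : Lp E p μ => integralFunctional μ Φ g := by
  refine ⟨convex_univ, fun f _ g _ a b _ _ hab => ?_⟩
  have hmeas : AEMeasurable (fun x => a * ENNReal.ofReal (Φ x (f x))) μ :=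
    (hΦ.aemeasurable_comp (Lp.aestronglyMeasurable f)).ennreal_ofReal.const_mul _
  calc integralFunctional μ Φ (a • f + b • g : Lp E p μ)
      ≤ ∫⁻ x, a * ENNReal.ofReal (Φ x (f x)) + b * ENNReal.ofReal (Φ x (g x)) ∂μ := by
        refine lintegral_mono_ae ?_
        filter_upwards [hΦ.convexOn, hΦ.nonneg, Lp.coeFn_add ((a : ℝ) • f) ((b : ℝ) • g),
          Lp.coeFn_smul (a : ℝ) f, Lp.coeFn_smul (b : ℝ) g] with x hx hx0 hadd hf hg
        rw [NNReal.smul_def, NNReal.smul_def, hadd, Pi.add_apply, hf, hg,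
          ← ENNReal.ofReal_coe_nnreal (p := a), ← ENNReal.ofReal_coe_nnreal (p := b),
          ← ENNReal.ofReal_mul a.coe_nonneg, ← ENNReal.ofReal_mul b.coe_nonneg,
          ← ENNReal.ofReal_add (mul_nonneg a.coe_nonneg (hx0 _))
            (mul_nonneg b.coe_nonneg (hx0 _))]
        exact ENNReal.ofReal_le_ofReal
          (hx.2 (Set.mem_univ _) (Set.mem_univ _) a.coe_nonneg b.coe_nonneg (mod_cast hab))
    _ = a • integralFunctional μ Φ f + b • integralFunctional μ Φ g := by
        rw [lintegral_add_left' hmeas, lintegral_const_mul' _ _ ENNReal.coe_ne_top,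
          lintegral_const_mul' _ _ ENNReal.coe_ne_top]
        rfl

theorem lowerSemicontinuous_integralFunctional [Fact (1 ≤ p)] (hΦ : IsConvexIntegrand μ Φ) :
    LowerSemicontinuous fun g : Lp E p μ => integralFunctional μ Φ g := by
  rw [lowerSemicontinuous_iff_isClosed_preimage]
  refine fun c => IsSeqClosed.isClosed fun f g hf hfg => ?_
  obtain ⟨n, -, hn⟩ := (tendstoInMeasure_of_tendsto_Lp hfg).exists_seq_tendsto_ae
  calc integralFunctional μ Φ g
      = ∫⁻ x, liminf (fun k => ENNReal.ofReal (Φ x (f (n k) x))) atTop ∂μ := by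
        refine lintegral_congr_ae ?_
        filter_upwards [hΦ.continuous, hn] with x hx hnx
        exact (((ENNReal.continuous_ofReal.comp hx).tendsto _).comp hnx).liminf_eq.symm
    _ ≤ liminf (fun k => integralFunctional μ Φ (f (n k))) atTop :=
        lintegral_liminf_le' fun k =>
          (hΦ.aemeasurable_comp (Lp.aestronglyMeasurable _)).ennreal_ofReal
    _ ≤ c := by
        refine liminf_le_of_le (by isBoundedDefault) fun b hb => ?_
        obtain ⟨k, hk⟩ := hb.exists
        exact hk.trans (hf (n k))

end IsConvexIntegrand

end ConvexIntegrand

section ExtIntegral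

variable {α : Type*} [MeasurableSpace α] {μ : Measure α} {f g h : α → ℝ}

theorem extIntegral_congr (hfg : f =ᵐ[μ] g) : extIntegral μ f = extIntegral μ g := by
  rw [extIntegral, extIntegral,
    lintegral_congr_ae (hfg.mono fun x hx => congrArg ENNReal.ofReal hx),
    lintegral_congr_ae (hfg.mono fun x hx => congrArg (fun t => ENNReal.ofReal (-t)) hx)]

theorem extIntegral_of_nonneg (hf : 0 ≤ᵐ[μ] f) :
    extIntegral μ f = (∫⁻ x, ENNReal.ofReal (f x) ∂μ : ℝ≥0∞) := by
  have hneg : ∫⁻ x, ENNReal.ofReal (-f x) ∂μ = 0 :=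
    lintegral_eq_zero_of_ae_eq_zero
      (hf.mono fun x hx => ENNReal.ofReal_of_nonpos (neg_nonpos.2 hx))
  rw [extIntegral, hneg, EReal.coe_ennreal_zero, sub_zero]

theorem extIntegral_of_integrable (hf : Integrable f μ) :
    extIntegral μ f = (∫ x, f x ∂μ : ℝ) := by
  have hneg : ∫⁻ x, ENNReal.ofReal (-f x) ∂μ ≠ ⊤ := hf.neg.lintegral_lt_top.ne
  rw [extIntegral, ← EReal.coe_ennreal_toReal hf.lintegral_lt_top.ne,
    ← EReal.coe_ennreal_toReal hneg, ← EReal.coe_sub,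
    integral_eq_lintegral_pos_part_sub_lintegral_neg_part hf]

theorem extIntegral_eq_top (hf : AEMeasurable f μ)
    (hneg : ∫⁻ x, ENNReal.ofReal (-f x) ∂μ ≠ ⊤) (hint : ¬ Integrable f μ) :
    extIntegral μ f = ⊤ := by
  have hpos : ∫⁻ x, ENNReal.ofReal (f x) ∂μ = ⊤ := by
    by_contra hpos
    refine hint ⟨hf.aestronglyMeasurable, ?_⟩
    have henorm : ∀ x, ‖f x‖ₑ ≤ ENNReal.ofReal (f x) + ENNReal.ofReal (-f x) := by
      intro x
      rw [← ofReal_norm, Real.norm_eq_abs]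
      rcases abs_choice (f x) with h | h <;> rw [h]
      exacts [le_self_add, le_add_self]
    refine (lintegral_mono henorm).trans_lt ?_
    rw [lintegral_add_left' hf.ennreal_ofReal]
    exact ENNReal.add_lt_top.2 ⟨lt_top_iff_ne_top.2 hpos, lt_top_iff_ne_top.2 hneg⟩
  rw [extIntegral, hpos, ← EReal.coe_ennreal_toReal hneg]
  rfl

theorem extIntegral_sub (hg : AEMeasurable g μ) (hg0 : 0 ≤ᵐ[μ] g) (hh : Integrable h μ) :
    extIntegral μ (g - h) =
      ((∫⁻ x, ENNReal.ofReal (g x) ∂μ : ℝ≥0∞) : EReal) - (∫ x, h x ∂μ : ℝ) := by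
  rw [← extIntegral_of_nonneg hg0]
  by_cases hgi : Integrable g μ
  · rw [extIntegral_of_integrable (hgi.sub hh), extIntegral_of_integrable hgi,
      integral_sub' hgi hh, EReal.coe_sub]
  have hgh : ¬ Integrable (g - h) μ := fun hgh => hgi (by simpa using hgh.add hh)
  have hneg : ∫⁻ x, ENNReal.ofReal (-(g - h) x) ∂μ ≠ ⊤ := by
    refine ((lintegral_mono_ae ?_).trans_lt hh.2).ne
    filter_upwards [hg0] with x hx
    refine (ENNReal.ofReal_le_ofReal ?_).trans (Real.ofReal_le_enorm _)
    rw [Pi.sub_apply, neg_sub]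
    exact sub_le_self _ hx
  have hneg' : ∫⁻ x, ENNReal.ofReal (-g x) ∂μ ≠ ⊤ := by
    rw [lintegral_eq_zero_of_ae_eq_zero
      (hg0.mono fun x hx => ENNReal.ofReal_of_nonpos (neg_nonpos.2 hx))]
    exact ENNReal.zero_ne_top
  rw [extIntegral_eq_top (hg.sub hh.aemeasurable) hneg hgh, extIntegral_eq_top hg hneg' hgi,
    EReal.top_sub_coe]

end ExtIntegral

section Semiconvex

/-- `F` completed by a quadratic function, `z ↦ F z + ω / 2 * |z|² + C`. -/
def addQuadratic (F : ℝ × ℝ → ℝ) (ω C : ℝ) (z : ℝ × ℝ) : ℝ :=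
  F z + (ω / 2 * (z.1 ^ 2 + z.2 ^ 2) + C)

theorem norm_sq_le_sq_add_sq (z : ℝ × ℝ) : ‖z‖ ^ 2 ≤ z.1 ^ 2 + z.2 ^ 2 := by
  rw [Prod.norm_def]
  rcases max_choice ‖z.1‖ ‖z.2‖ with h | h <;> rw [h, Real.norm_eq_abs, sq_abs]
  exacts [le_add_of_nonneg_right (sq_nonneg _), le_add_of_nonneg_left (sq_nonneg _)]

theorem convexOn_sq_add_sq : ConvexOn ℝ Set.univ fun z : ℝ × ℝ => z.1 ^ 2 + z.2 ^ 2 :=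
  have hsq : ConvexOn ℝ Set.univ fun t : ℝ => t ^ 2 := even_two.convexOn_pow
  (hsq.comp_linearMap (LinearMap.fst ℝ ℝ ℝ)).add (hsq.comp_linearMap (LinearMap.snd ℝ ℝ ℝ))

theorem exists_affine_le_of_convexOn_univ {E : Type*} [NormedAddCommGroup E] [NormedSpace ℝ E]
    [FiniteDimensional ℝ E] {f : E → ℝ} (hf : ConvexOn ℝ Set.univ f) :
    ∃ (D : E →L[ℝ] ℝ) (c : ℝ), ∀ z, D z + c ≤ f z := by
  obtain ⟨D, c, hDc, -⟩ := hf.exists_affine_le_of_lt (𝕜 := ℝ) (Set.mem_univ 0)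
    (sub_one_lt (f 0)) isClosed_univ
    (hf.locallyLipschitz.continuous.lowerSemicontinuous.lowerSemicontinuousOn _)
  exact ⟨D, c, fun z => hDc ⟨z, Set.mem_univ z⟩⟩

theorem IsSemiconvex.exists_convexOn_addQuadratic {F : ℝ × ℝ → ℝ} (hF : IsSemiconvex F) :
    ∃ ω C : ℝ, ConvexOn ℝ Set.univ (addQuadratic F ω C) ∧ ∀ z, ‖z‖ ^ 2 ≤ addQuadratic F ω C z := by
  obtain ⟨ω, hω⟩ := hF
  obtain ⟨D, c, hDc⟩ := exists_affine_le_of_convexOn_univ hω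
  refine ⟨ω + 4, ‖D‖ ^ 2 / 4 - c, ?_, fun z => ?_⟩
  · refine ((hω.add (convexOn_sq_add_sq.smul (c := 2) zero_le_two)).add_const
      (‖D‖ ^ 2 / 4 - c)).congr fun z _ => ?_
    simp only [Pi.add_apply, smul_eq_mul, addQuadratic]
    ring
  · have hD : -(‖D‖ * ‖z‖) ≤ D z := neg_le_of_abs_le (D.le_opNorm z)
    have hyoung : ‖D‖ * ‖z‖ ≤ ‖z‖ ^ 2 + ‖D‖ ^ 2 / 4 := by nlinarith [sq_nonneg (‖z‖ - ‖D‖ / 2)]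
    simp only [addQuadratic]
    linarith [hDc z, norm_sq_le_sq_add_sq z]

end Semiconvex

section ConvexFun

variable {V : Type*} [NormedAddCommGroup V] [NormedSpace ℝ V] {E E₁ E₂ : V → EReal}

theorem isConvexFun_coe {K : V → ℝ≥0∞} (hK : ConvexOn NNReal Set.univ K) :
    IsConvexFun fun u => (K u : EReal) := by
  intro u v a b ha hb hab
  lift a to NNReal using ha
  lift b to NNReal using hb
  have h := hK.2 (Set.mem_univ u) (Set.mem_univ v) a.2 b.2 (mod_cast hab)
  rw [← EReal.coe_ennreal_le_coe_ennreal_iff] at h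
  simpa only [EReal.coe_ennreal_add, ENNReal.smul_def, smul_eq_mul, EReal.coe_ennreal_mul,
    EReal.coe_nnreal_eq_coe_real, NNReal.smul_def] using h

namespace IsConvexFun

theorem add (h₁ : IsConvexFun E₁) (h₂ : IsConvexFun E₂) :
    IsConvexFun fun u => E₁ u + E₂ u := by
  intro u v a b ha hb hab
  calc E₁ (a • u + b • v) + E₂ (a • u + b • v)
      ≤ (a * E₁ u + b * E₁ v) + (a * E₂ u + b * E₂ v) :=
        add_le_add (h₁ u v a b ha hb hab) (h₂ u v a b ha hb hab)
    _ = a * (E₁ u + E₂ u) + b * (E₁ v + E₂ v) := by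
        rw [EReal.left_distrib_of_nonneg_of_ne_top (mod_cast ha) (EReal.coe_ne_top a),
          EReal.left_distrib_of_nonneg_of_ne_top (mod_cast hb) (EReal.coe_ne_top b),
          add_add_add_comm]

theorem sub_const (hE : IsConvexFun E) (c : ℝ) : IsConvexFun fun u => E u - c := by
  have hc : IsConvexFun fun _ : V => ((-c : ℝ) : EReal) := by
    intro u v a b _ _ hab
    rw [← EReal.coe_mul, ← EReal.coe_mul, ← EReal.coe_add, ← add_mul, hab, one_mul]
  exact hE.add hc

end IsConvexFun

theorem IsConvexIntegrand.isConvexFun_comp {α X : Type*} [MeasurableSpace α] {μ : Measure α}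
    [NormedAddCommGroup X] [NormedSpace ℝ X] [FiniteDimensional ℝ X] {p : ℝ≥0∞} [Fact (1 ≤ p)]
    {Φ : α → X → ℝ} (hΦ : IsConvexIntegrand μ Φ) (L : V →L[ℝ] Lp X p μ) :
    IsConvexFun fun u => (integralFunctional μ Φ (L u) : EReal) :=
  isConvexFun_coe <|
    hΦ.convexOn_integralFunctional.comp_linearMap (L.toLinearMap.restrictScalars NNReal)

end ConvexFun

section LpProd

variable {α E F : Type*} [MeasurableSpace α] {μ : Measure α} {p : ℝ≥0∞} [Fact (1 ≤ p)]
  [NormedAddCommGroup E] [NormedSpace ℝ E] [NormedAddCommGroup F] [NormedSpace ℝ F]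

/-- The map `(f, g) ↦ (x ↦ (f x, g x))` from `Lᵖ(E) × Lᵖ(F)` to `Lᵖ(E × F)`. -/
def lpProd : Lp E p μ × Lp F p μ →L[ℝ] Lp (E × F) p μ :=
  (ContinuousLinearMap.inl ℝ E F).compLpL p μ ∘L ContinuousLinearMap.fst ℝ _ _ +
    (ContinuousLinearMap.inr ℝ E F).compLpL p μ ∘L ContinuousLinearMap.snd ℝ _ _

theorem coeFn_lpProd (z : Lp E p μ × Lp F p μ) : lpProd z =ᵐ[μ] fun x => (z.1 x, z.2 x) := by
  filter_upwards [Lp.coeFn_add ((ContinuousLinearMap.inl ℝ E F).compLpL p μ z.1)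
      ((ContinuousLinearMap.inr ℝ E F).compLpL p μ z.2),
    (ContinuousLinearMap.inl ℝ E F).coeFn_compLpL z.1,
    (ContinuousLinearMap.inr ℝ E F).coeFn_compLpL z.2] with x hadd hf hg
  refine hadd.trans ?_
  rw [Pi.add_apply, hf, hg, ContinuousLinearMap.inl_apply, ContinuousLinearMap.inr_apply,
    Prod.mk_add_mk, add_zero, zero_add]

theorem norm_le_norm_lpProd (z : Lp E p μ × Lp F p μ) : ‖z‖ ≤ ‖lpProd z‖ := by
  refine norm_prod_le_iff.2 ⟨Lp.norm_le_norm_of_ae_le ?_, Lp.norm_le_norm_of_ae_le ?_⟩ <;>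
    filter_upwards [coeFn_lpProd z] with x hx <;> rw [hx]
  exacts [norm_fst_le (z.1 x, z.2 x), norm_snd_le (z.1 x, z.2 x)]

theorem norm_sq_eq_integral (f : Lp ℝ 2 μ) : ‖f‖ ^ 2 = ∫ x, f x ^ 2 ∂μ := by
  rw [← real_inner_self_eq_norm_sq, L2.inner_def]
  simp only [real_inner_self_eq_norm_sq, Real.norm_eq_abs, sq_abs]

theorem integral_sq_lpProd (f g : Lp ℝ 2 μ) :
    ∫ x, ((lpProd (f, g) x).1 ^ 2 + (lpProd (f, g) x).2 ^ 2) ∂μ = ‖f‖ ^ 2 + ‖g‖ ^ 2 := by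
  rw [norm_sq_eq_integral, norm_sq_eq_integral,
    ← integral_add (Lp.memLp f).integrable_sq (Lp.memLp g).integrable_sq]
  refine integral_congr_ae ?_
  filter_upwards [coeFn_lpProd (f, g)] with x hx
  rw [hx]

end LpProd

section IonicIntegral

variable {α : Type*} [MeasurableSpace α] {μ : Measure α}

theorem integrable_sq_add_sq (s : Lp (ℝ × ℝ) 2 μ) :
    Integrable (fun x => (s x).1 ^ 2 + (s x).2 ^ 2) μ :=
  (Lp.memLp s).fst.integrable_sq.add (Lp.memLp s).snd.integrable_sq

theorem IsConvexIntegrand.extIntegral_eq [IsFiniteMeasure μ] {F : ℝ × ℝ → ℝ} {ω C : ℝ}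
    (hG : IsConvexIntegrand μ fun _ => addQuadratic F ω C) (s : Lp (ℝ × ℝ) 2 μ) :
    extIntegral μ (fun x => F (s x)) =
      (integralFunctional μ (fun _ => addQuadratic F ω C) s : EReal) -
        (ω / 2 * ∫ x, ((s x).1 ^ 2 + (s x).2 ^ 2) ∂μ + C * μ.real Set.univ : ℝ) := by
  have hquad := (integrable_sq_add_sq s).const_mul (ω / 2)
  have hsum : Integrable (fun x => ω / 2 * ((s x).1 ^ 2 + (s x).2 ^ 2) + C) μ :=
    hquad.add (integrable_const C)
  have hF : (fun x => F (s x)) = (fun x => addQuadratic F ω C (s x)) -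
      fun x => ω / 2 * ((s x).1 ^ 2 + (s x).2 ^ 2) + C :=
    funext fun x => (add_sub_cancel_right _ _).symm
  rw [hF, extIntegral_sub (hG.aemeasurable_comp (Lp.aestronglyMeasurable s))
    (hG.nonneg.mono fun x hx => hx (s x)) hsum, integral_add hquad (integrable_const C),
    integral_const_mul, integral_const, smul_eq_mul, mul_comm C]
  rfl

end IonicIntegral

section ConvexFluxPotential

variable {N : ℕ} {p : ℝ≥0∞} {Ω : Set (Eucl N)} {Q : Eucl N → Eucl N → ℝ}

/-- The assumptions on `Q : Ω × ℝᴺ → ℝ` without smoothness and strictness: measurable in the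
first variable, convex in the second, `Q(x,0) = 0` and `Q(x,y) ≥ α |y|ᵖ`. -/
structure IsConvexFluxPotential (p : ℝ≥0∞) (Ω : Set (Eucl N)) (Q : Eucl N → Eucl N → ℝ) :
    Prop where
  aemeasurable : ∀ y, AEMeasurable (fun x => Q x y) (leb Ω)
  convexOn : ∀ x ∈ Ω, ConvexOn ℝ Set.univ (Q x)
  map_zero : ∀ x ∈ Ω, Q x 0 = 0
  lower_bound : ∃ α > (0 : ℝ), ∀ x ∈ Ω, ∀ y, α * ‖y‖ ^ p.toReal ≤ Q x y

theorem IsFluxPotential.isConvexFluxPotential (hQ : IsFluxPotential p Ω Q) :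
    IsConvexFluxPotential p Ω Q where
  aemeasurable := hQ.aemeasurable
  convexOn x hx := (hQ.strictConvexOn x hx).convexOn
  map_zero := hQ.map_zero
  lower_bound := hQ.lower_bound

namespace IsConvexFluxPotential

theorem nonneg (hQ : IsConvexFluxPotential p Ω Q) {x : Eucl N} (hx : x ∈ Ω) (y : Eucl N) :
    0 ≤ Q x y := by
  obtain ⟨α, hα, h⟩ := hQ.lower_bound
  exact le_trans (by positivity) (h x hx y)

theorem isConvexIntegrand (hQ : IsConvexFluxPotential p Ω Q) (hΩ : MeasurableSet Ω) :
    IsConvexIntegrand (leb Ω) Q where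
  aemeasurable := hQ.aemeasurable
  convexOn := (ae_restrict_mem hΩ).mono hQ.convexOn
  nonneg := (ae_restrict_mem hΩ).mono fun _ hx => hQ.nonneg hx

theorem isBounded_setOf_le [Fact (1 ≤ p)] (hQ : IsConvexFluxPotential p Ω Q) (hp : p ≠ ⊤)
    (hΩ : MeasurableSet Ω) (M : NNReal) :
    Bornology.IsBounded {g : Lp (Eucl N) p (leb Ω) | integralFunctional (leb Ω) Q g ≤ M} := by
  obtain ⟨α, hα, h⟩ := hQ.lower_bound
  exact isBounded_setOf_integralFunctional_le hp hα ((ae_restrict_mem hΩ).mono h) M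

end IsConvexFluxPotential

end ConvexFluxPotential

section EnergyFormula

open scoped NNReal

variable {N : ℕ} {p : ℝ≥0∞} [Fact (1 ≤ p)] {Ω Ω' : Set (Eucl N)} {hsub : Ω ⊆ Ω'}
  {hb : Bornology.IsBounded Ω}

variable (p hsub hb) in
/-- The map `(u_i, u_e, w) ↦ ∇u_i`. -/
def gradientᵢ : EnergySpace p hsub hb →L[ℝ] Lp (Eucl N) p (leb Ω) :=
  ContinuousLinearMap.snd ℝ _ _ ∘L (Sobolev p Ω).subtypeL ∘L ContinuousLinearMap.fst ℝ _ _ ∘L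
    (EnergySpace p hsub hb).subtypeL

variable (p hsub hb) in
/-- The map `(u_i, u_e, w) ↦ ∇u_e`. -/
def gradientₑ : EnergySpace p hsub hb →L[ℝ] Lp (Eucl N) p (leb Ω') :=
  ContinuousLinearMap.snd ℝ _ _ ∘L (Sobolev p Ω').subtypeL ∘L ContinuousLinearMap.fst ℝ _ _ ∘L
    ContinuousLinearMap.snd ℝ _ _ ∘L (EnergySpace p hsub hb).subtypeL

variable (p hsub hb) in
/-- The map `j` with values in the `ℝ²`-valued functions: `ionicState z x` is
`(u_i x - u_e x, w x)`, the argument of the ionic term `F` of the energy. -/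
def ionicState : EnergySpace p hsub hb →L[ℝ] Lp (ℝ × ℝ) 2 (leb Ω) :=
  lpProd ∘L (WithLp.prodContinuousLinearEquiv 2 ℝ (Lp ℝ 2 (leb Ω)) (Lp ℝ 2 (leb Ω)) :
    HilbertL2 Ω →L[ℝ] Lp ℝ 2 (leb Ω) × Lp ℝ 2 (leb Ω)) ∘L jMap p hsub hb

/-- The energy for a nonnegative `G` in place of `F`, with values in `[0, ∞]`. -/
def nonnegEnergy (Qᵢ Qₑ : Eucl N → Eucl N → ℝ) (G : ℝ × ℝ → ℝ) (z : EnergySpace p hsub hb) :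
    ℝ≥0∞ :=
  integralFunctional (leb Ω) Qᵢ (gradientᵢ p hsub hb z) +
    integralFunctional (leb Ω') Qₑ (gradientₑ p hsub hb z) +
    integralFunctional (leb Ω) (fun _ => G) (ionicState p hsub hb z)

theorem coeFn_ionicState (z : EnergySpace p hsub hb) :
    ionicState p hsub hb z =ᵐ[leb Ω] fun x => (uᵢ z x - uₑ z x, wComp z x) := by
  filter_upwards [coeFn_lpProd (z.1.2.2.2, z.1.2.2.1), jMap_fst z] with x hx hfst
  exact hx.trans (Prod.ext hfst rfl)

theorem integral_sq_ionicState (z : EnergySpace p hsub hb) :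
    ∫ x in Ω, ((ionicState p hsub hb z x).1 ^ 2 + (ionicState p hsub hb z x).2 ^ 2) =
      ‖jMap p hsub hb z‖ ^ 2 :=
  (integral_sq_lpProd _ _).trans (WithLp.prod_norm_sq_eq_of_L2 (jMap p hsub hb z)).symm

theorem norm_fst_le_norm_ionicState (z : EnergySpace p hsub hb) :
    ‖(jMap p hsub hb z).fst‖ ≤ ‖ionicState p hsub hb z‖ :=
  (norm_prod_le_iff.1 (norm_le_norm_lpProd (z.1.2.2.2, z.1.2.2.1))).1

theorem norm_snd_le_norm_ionicState (z : EnergySpace p hsub hb) :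
    ‖(jMap p hsub hb z).snd‖ ≤ ‖ionicState p hsub hb z‖ :=
  (norm_prod_le_iff.1 (norm_le_norm_lpProd (z.1.2.2.2, z.1.2.2.1))).2

theorem energyᵢ_eq {Qᵢ : Eucl N → Eucl N → ℝ} (hΩ : MeasurableSet Ω)
    (hQᵢ : IsConvexFluxPotential p Ω Qᵢ) (z : EnergySpace p hsub hb) :
    energyᵢ Qᵢ z = integralFunctional (leb Ω) Qᵢ (gradientᵢ p hsub hb z) :=
  extIntegral_of_nonneg ((hQᵢ.isConvexIntegrand hΩ).nonneg.mono fun _ hx => hx _)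

theorem energyₑ_eq {Qₑ : Eucl N → Eucl N → ℝ} (hΩ' : MeasurableSet Ω')
    (hQₑ : IsConvexFluxPotential p Ω' Qₑ) (z : EnergySpace p hsub hb) :
    energyₑ Qₑ z = integralFunctional (leb Ω') Qₑ (gradientₑ p hsub hb z) :=
  extIntegral_of_nonneg ((hQₑ.isConvexIntegrand hΩ').nonneg.mono fun _ hx => hx _)

theorem energyF_eq {F : ℝ × ℝ → ℝ} {ω C : ℝ}
    (hG : IsConvexIntegrand (leb Ω) fun _ => addQuadratic F ω C) (z : EnergySpace p hsub hb) :
    energyF F z =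
      (integralFunctional (leb Ω) (fun _ => addQuadratic F ω C) (ionicState p hsub hb z) : EReal) -
        (ω / 2 * ‖jMap p hsub hb z‖ ^ 2 + C * (leb Ω).real Set.univ : ℝ) := by
  have := isFiniteMeasure_leb hb
  have hF : energyF F z = extIntegral (leb Ω) fun x => F (ionicState p hsub hb z x) :=
    extIntegral_congr ((coeFn_ionicState z).mono fun x hx => congrArg F hx.symm)
  have hsq := integral_sq_ionicState z
  have hs := hG.extIntegral_eq (ionicState p hsub hb z)
  rw [hsq] at hs
  exact hF.trans hs

theorem energy_eq {Qᵢ Qₑ : Eucl N → Eucl N → ℝ} (hΩ : MeasurableSet Ω) (hΩ' : MeasurableSet Ω')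
    (hQᵢ : IsConvexFluxPotential p Ω Qᵢ) (hQₑ : IsConvexFluxPotential p Ω' Qₑ) {F : ℝ × ℝ → ℝ}
    {ω C : ℝ} (hG : IsConvexIntegrand (leb Ω) fun _ => addQuadratic F ω C)
    (z : EnergySpace p hsub hb) :
    energy p hsub hb Qᵢ Qₑ F z = (nonnegEnergy Qᵢ Qₑ (addQuadratic F ω C) z : EReal) -
      (ω / 2 * ‖jMap p hsub hb z‖ ^ 2 + C * (leb Ω).real Set.univ : ℝ) := by
  simp only [energy, energyᵢ_eq hΩ hQᵢ, energyₑ_eq hΩ' hQₑ, energyF_eq hG, nonnegEnergy,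
    EReal.coe_ennreal_add, sub_eq_add_neg, add_assoc]

theorem isConvexFun_nonnegEnergy {Qᵢ Qₑ : Eucl N → Eucl N → ℝ} {G : ℝ × ℝ → ℝ}
    (hQᵢ : IsConvexIntegrand (leb Ω) Qᵢ) (hQₑ : IsConvexIntegrand (leb Ω') Qₑ)
    (hG : IsConvexIntegrand (leb Ω) fun _ => G) :
    IsConvexFun fun z : EnergySpace p hsub hb => (nonnegEnergy Qᵢ Qₑ G z : EReal) := by
  simp only [nonnegEnergy, EReal.coe_ennreal_add]
  have hᵢ := hQᵢ.isConvexFun_comp (V := EnergySpace p hsub hb) (gradientᵢ p hsub hb)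
  have hₑ := hQₑ.isConvexFun_comp (V := EnergySpace p hsub hb) (gradientₑ p hsub hb)
  have hF := hG.isConvexFun_comp (V := EnergySpace p hsub hb) (ionicState p hsub hb)
  exact (hᵢ.add hₑ).add hF

theorem lowerSemicontinuous_nonnegEnergy {Qᵢ Qₑ : Eucl N → Eucl N → ℝ} {G : ℝ × ℝ → ℝ}
    (hQᵢ : IsConvexIntegrand (leb Ω) Qᵢ) (hQₑ : IsConvexIntegrand (leb Ω') Qₑ)
    (hG : IsConvexIntegrand (leb Ω) fun _ => G) :
    LowerSemicontinuous (nonnegEnergy (p := p) (hsub := hsub) (hb := hb) Qᵢ Qₑ G) :=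
  ((hQᵢ.lowerSemicontinuous_integralFunctional.comp (gradientᵢ p hsub hb).continuous).add
    (hQₑ.lowerSemicontinuous_integralFunctional.comp (gradientₑ p hsub hb).continuous)).add
    (hG.lowerSemicontinuous_integralFunctional.comp (ionicState p hsub hb).continuous)

theorem integral_uᵢ_eq (z : EnergySpace p hsub hb) :
    ∫ x in Ω, uᵢ z x = ∫ x in Ω, (jMap p hsub hb z).fst x := by
  have := isFiniteMeasure_leb hb
  have hp : 1 ≤ p := Fact.out
  have huᵢ : Integrable (uᵢ z) (leb Ω) := (Lp.memLp z.1.1.1.1).integrable hp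
  have huₑ : Integrable (uₑ z) (leb Ω) := integrable_restrict hp hsub hb _
  have huₑ0 : ∫ x in Ω, uₑ z x = 0 := z.2.1
  rw [integral_congr_ae (jMap_fst z), integral_sub huᵢ huₑ, huₑ0, sub_zero]

theorem exists_abs_integral_uᵢ_le (hm : MeasurableSet Ω) :
    ∃ L : ℝ, 0 ≤ L ∧ ∀ z : EnergySpace p hsub hb,
      |∫ x in Ω, uᵢ z x| ≤ L * ‖ionicState p hsub hb z‖ := by
  have := isFiniteMeasure_leb hb
  obtain ⟨ℓ, hℓ⟩ := exists_clm_eq_setIntegral (p := 2) (μ := volume) hm (subset_refl Ω)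
  refine ⟨‖ℓ‖, norm_nonneg ℓ, fun z => ?_⟩
  have hv : ‖ℓ (jMap p hsub hb z).fst‖ ≤ ‖ℓ‖ * ‖ionicState p hsub hb z‖ :=
    ℓ.le_opNorm_of_le (norm_fst_le_norm_ionicState z)
  rwa [hℓ, ← integral_uᵢ_eq] at hv

theorem exists_norm_uᵢ_le (hΩ : IsPoincareSet p Ω Ω) (hm : MeasurableSet Ω)
    (hΩ0 : volume Ω ≠ 0) :
    ∃ C L : ℝ, 0 ≤ C ∧ 0 ≤ L ∧ ∀ z : EnergySpace p hsub hb,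
      ‖z.1.1.1.1‖ ≤ C * (‖gradientᵢ p hsub hb z‖ + L * ‖ionicState p hsub hb z‖) := by
  have := isFiniteMeasure_leb hb
  obtain ⟨L, hL, hint⟩ := exists_abs_integral_uᵢ_le (p := p) (hsub := hsub) (hb := hb) hm
  refine (hΩ.exists_norm_le hm (subset_refl Ω) hΩ0).imp fun C hC => ⟨L, hC.1, hL, fun z => ?_⟩
  have hi : |∫ x in Ω, z.1.1.1.1 x| ≤ L * ‖ionicState p hsub hb z‖ := hint z
  have h : ‖z.1.1.1.2‖ + |∫ x in Ω, z.1.1.1.1 x| ≤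
      ‖z.1.1.1.2‖ + L * ‖ionicState p hsub hb z‖ := add_le_add le_rfl hi
  exact (hC.2 z.1.1).trans (mul_le_mul_of_nonneg_left h hC.1)

theorem exists_norm_uₑ_le (hΩ' : IsPoincareSet p Ω' Ω') (hb' : Bornology.IsBounded Ω')
    (hm : MeasurableSet Ω) (hΩ0 : volume Ω ≠ 0) :
    ∃ C : ℝ, 0 ≤ C ∧ ∀ z : EnergySpace p hsub hb, ‖z.1.2.1.1.1‖ ≤ C * ‖gradientₑ p hsub hb z‖ := by
  have := isFiniteMeasure_leb hb'
  obtain ⟨C, hC, hP⟩ := hΩ'.exists_norm_le hm hsub hΩ0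
  refine ⟨C, hC, fun z => ?_⟩
  have h0 : ∫ x in Ω, z.1.2.1.1.1 x = 0 := z.2.1
  have h := hP z.1.2.1
  rwa [h0, abs_zero, add_zero] at h

theorem isBounded_of_isBounded_image (hp : p ≠ ⊤) (hΩ : IsContinuousDomain Ω)
    (hΩ' : IsContinuousDomain Ω') {S : Set (EnergySpace p hsub hb)}
    (hᵢ : Bornology.IsBounded (gradientᵢ p hsub hb '' S))
    (hₑ : Bornology.IsBounded (gradientₑ p hsub hb '' S))
    (hs : Bornology.IsBounded (ionicState p hsub hb '' S)) : Bornology.IsBounded S := by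
  have hp1 : 1 ≤ p := Fact.out
  have hm := hΩ.isOpen.measurableSet
  have hΩ0 : volume Ω ≠ 0 := hΩ.isOpen.measure_ne_zero volume hΩ.isConnected.nonempty
  obtain ⟨Cᵢ, L, hCᵢ, hL, huᵢ⟩ :=
    exists_norm_uᵢ_le (hsub := hsub) (hb := hb) (hΩ.isPoincareSet hp1 hp) hm hΩ0
  obtain ⟨Cₑ, hCₑ, huₑ⟩ := exists_norm_uₑ_le (hsub := hsub) (hb := hb)
    (hΩ'.isPoincareSet hp1 hp) hΩ'.isBounded hm hΩ0
  obtain ⟨Rᵢ, hRᵢ⟩ := hᵢ.exists_norm_le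
  obtain ⟨Rₑ, hRₑ⟩ := hₑ.exists_norm_le
  obtain ⟨R, hR⟩ := hs.exists_norm_le
  rw [Set.forall_mem_image] at hRᵢ hRₑ hR
  refine (isBounded_iff_forall_norm_le (E := EnergySpace p hsub hb)).2
    ⟨max (max (Cᵢ * (Rᵢ + L * R)) Rᵢ) (max (max (Cₑ * Rₑ) Rₑ) R), fun z hz => ?_⟩
  have hzᵢ : ‖z.1.1.1.1‖ ≤ Cᵢ * (Rᵢ + L * R) :=
    (huᵢ z).trans (mul_le_mul_of_nonneg_left
      (add_le_add (hRᵢ hz) (mul_le_mul_of_nonneg_left (hR hz) hL)) hCᵢ)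
  have hzₑ : ‖z.1.2.1.1.1‖ ≤ Cₑ * Rₑ :=
    (huₑ z).trans (mul_le_mul_of_nonneg_left (hRₑ hz) hCₑ)
  have hw := (norm_snd_le_norm_ionicState z).trans (hR hz)
  have hv := (norm_fst_le_norm_ionicState z).trans (hR hz)
  exact max_le_max (max_le_max hzᵢ (hRᵢ hz))
    (max_le_max (max_le_max hzₑ (hRₑ hz)) (max_le hw hv))

theorem isBounded_setOf_nonnegEnergy_le {Qᵢ Qₑ : Eucl N → Eucl N → ℝ} (hp : p ≠ ⊤)
    (hΩ : IsContinuousDomain Ω) (hΩ' : IsContinuousDomain Ω')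
    (hQᵢ : IsConvexFluxPotential p Ω Qᵢ) (hQₑ : IsConvexFluxPotential p Ω' Qₑ)
    {G : ℝ × ℝ → ℝ} (hG : ∀ s, ‖s‖ ^ 2 ≤ G s) (M : ℝ≥0) :
    Bornology.IsBounded {z : EnergySpace p hsub hb | nonnegEnergy Qᵢ Qₑ G z ≤ M} := by
  have hGb : Bornology.IsBounded
      {s : Lp (ℝ × ℝ) 2 (leb Ω) | integralFunctional (leb Ω) (fun _ => G) s ≤ M} :=
    isBounded_setOf_integralFunctional_le ENNReal.ofNat_ne_top one_pos
      (ae_of_all _ fun _ s => by simpa using hG s) M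
  refine isBounded_of_isBounded_image hp hΩ hΩ'
    ((hQᵢ.isBounded_setOf_le hp hΩ.isOpen.measurableSet M).subset ?_)
    ((hQₑ.isBounded_setOf_le hp hΩ'.isOpen.measurableSet M).subset ?_) (hGb.subset ?_)
  · rintro _ ⟨z, hz, rfl⟩
    rw [Set.mem_ofPred_eq, nonnegEnergy] at hz
    exact (le_self_add.trans le_self_add).trans hz
  · rintro _ ⟨z, hz, rfl⟩
    rw [Set.mem_ofPred_eq, nonnegEnergy] at hz
    exact (le_add_self.trans le_self_add).trans hz
  · rintro _ ⟨z, hz, rfl⟩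
    rw [Set.mem_ofPred_eq, nonnegEnergy] at hz
    exact le_add_self.trans hz

end EnergyFormula

section TestFunctions

variable {N : ℕ} {Ω : Set (Eucl N)} {φ : Eucl N → ℝ}

theorem isWeakGradient_gradient (hφ : ContDiff ℝ 1 φ) : IsWeakGradient Ω φ (gradient φ) := by
  intro η hη hηc hηs y
  have hη0 : ∀ x ∉ Ω, η x = 0 := fun x hx =>
    image_eq_zero_of_notMem_tsupport fun h => hx (hηs h)
  have hdη0 : ∀ x ∉ Ω, fderiv ℝ η x y = 0 := fun x hx => by
    rw [image_eq_zero_of_notMem_tsupport fun h => hx (hηs (tsupport_fderiv_subset ℝ h)),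
      zero_apply]
  rw [setIntegral_eq_integral_of_forall_compl_eq_zero fun x hx => by rw [hdη0 x hx, zero_mul],
    setIntegral_eq_integral_of_forall_compl_eq_zero fun x hx => by rw [hη0 x hx, zero_mul]]
  simp only [inner_gradient_left]
  have hdη : Continuous fun x => fderiv ℝ η x y :=
    (hη.continuous_fderiv (by simp)).clm_apply continuous_const
  have hdφ : Continuous fun x => fderiv ℝ φ x y :=
    (hφ.continuous_fderiv one_ne_zero).clm_apply continuous_const
  rw [integral_mul_fderiv_eq_neg_fderiv_mul_of_integrable, neg_neg]
  · exact (hdη.mul hφ.continuous).integrable_of_hasCompactSupport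
      (hηc.fderiv_apply ℝ y).mul_right
  · exact (hη.continuous.mul hdφ).integrable_of_hasCompactSupport hηc.mul_right
  · exact (hη.continuous.mul hφ.continuous).integrable_of_hasCompactSupport hηc.mul_right
  · exact fun x _ => hη.differentiable (by simp) x
  · exact fun x _ => hφ.differentiable one_ne_zero x

theorem tsupport_gradient_subset (φ : Eucl N → ℝ) : tsupport (gradient φ) ⊆ tsupport φ := by
  refine closure_minimal (fun x hx => ?_) (isClosed_tsupport φ)
  by_contra hxφ
  have h : fderiv ℝ φ x = 0 :=
    image_eq_zero_of_notMem_tsupport fun h => hxφ (tsupport_fderiv_subset ℝ h)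
  exact hx (by rw [gradient, h, map_zero])

/-- `φ ∈ C_c^∞(Ω)`. -/
structure IsTestFunction (Ω : Set (Eucl N)) (φ : Eucl N → ℝ) : Prop where
  contDiff : ContDiff ℝ (⊤ : ℕ∞) φ
  hasCompactSupport : HasCompactSupport φ
  tsupport_subset : tsupport φ ⊆ Ω

namespace IsTestFunction

theorem memLp (hφ : IsTestFunction Ω φ) (q : ℝ≥0∞) : MemLp φ q (leb Ω) :=
  (hφ.contDiff.continuous.memLp_of_hasCompactSupport hφ.hasCompactSupport).restrict Ω

theorem continuous_gradient (hφ : IsTestFunction Ω φ) : Continuous (gradient φ) :=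
  (InnerProductSpace.toDual ℝ (Eucl N)).symm.continuous.comp
    (hφ.contDiff.continuous_fderiv (by simp))

theorem hasCompactSupport_gradient (hφ : IsTestFunction Ω φ) : HasCompactSupport (gradient φ) :=
  hφ.hasCompactSupport.mono' ((subset_tsupport _).trans (tsupport_gradient_subset φ))

theorem memLp_gradient (hφ : IsTestFunction Ω φ) (q : ℝ≥0∞) : MemLp (gradient φ) q (leb Ω) :=
  (hφ.continuous_gradient.memLp_of_hasCompactSupport hφ.hasCompactSupport_gradient).restrict Ω

/-- A test function as an element of the Sobolev space. -/
def toSobolev (hφ : IsTestFunction Ω φ) (p : ℝ≥0∞) [Fact (1 ≤ p)] : Sobolev p Ω :=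
  ⟨((hφ.memLp p).toLp φ, (hφ.memLp_gradient p).toLp (gradient φ)),
    (isWeakGradient_gradient (hφ.contDiff.of_le (mod_cast le_top))).congr_ae
      (hφ.memLp p).coeFn_toLp.symm (hφ.memLp_gradient p).coeFn_toLp.symm⟩

end IsTestFunction

/-- The test functions as a subspace of `L²(Ω)`. -/
def testSubmodule (Ω : Set (Eucl N)) : Submodule ℝ (Lp ℝ 2 (leb Ω)) where
  carrier := {f | ∃ (φ : Eucl N → ℝ) (hφ : IsTestFunction Ω φ), f = (hφ.memLp 2).toLp φ}
  zero_mem' := ⟨0, ⟨contDiff_const, HasCompactSupport.zero, by simp⟩, (MemLp.toLp_zero _).symm⟩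
  add_mem' := by
    rintro _ _ ⟨φ, hφ, rfl⟩ ⟨ψ, hψ, rfl⟩
    exact ⟨φ + ψ, ⟨hφ.contDiff.add hψ.contDiff, hφ.hasCompactSupport.add hψ.hasCompactSupport,
      (tsupport_add _ _).trans (Set.union_subset hφ.tsupport_subset hψ.tsupport_subset)⟩,
      (MemLp.toLp_add _ _).symm⟩
  smul_mem' := by
    rintro c _ ⟨φ, hφ, rfl⟩
    exact ⟨c • φ, ⟨hφ.contDiff.const_smul c, hφ.hasCompactSupport.smul_left,
      (closure_mono (Function.support_const_smul_subset c φ)).trans hφ.tsupport_subset⟩,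
      (MemLp.toLp_const_smul _ _).symm⟩

theorem dense_testSubmodule (hΩ : IsOpen Ω) : Dense (testSubmodule Ω : Set (Lp ℝ 2 (leb Ω))) := by
  rw [Submodule.dense_iff_topologicalClosure_eq_top, Submodule.topologicalClosure_eq_top_iff,
    Submodule.eq_bot_iff]
  intro f hf
  have horth : ∀ φ, IsTestFunction Ω φ → ∫ x in Ω, φ x • f x = 0 := fun φ hφ => by
    rw [← (Submodule.mem_orthogonal _ _).1 hf _ ⟨φ, hφ, rfl⟩, L2.inner_def]
    refine integral_congr_ae ?_
    filter_upwards [(hφ.memLp 2).coeFn_toLp] with x hx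
    rw [hx, smul_eq_mul, Real.inner_apply]
  have hf0 := hΩ.ae_eq_zero_of_integral_contDiff_smul_eq_zero (μ := leb Ω)
    (((Lp.memLp f).locallyIntegrable one_le_two).locallyIntegrableOn Ω)
    fun φ hφ hφc hφΩ => horth φ ⟨hφ, hφc, hφΩ⟩
  rw [Lp.eq_zero_iff_ae_eq_zero]
  filter_upwards [hf0, ae_restrict_mem hΩ.measurableSet] with x hx hxΩ
  exact hx hxΩ

end TestFunctions

section FiniteEnergy

variable {α E : Type*} [MeasurableSpace α] {μ : Measure α} [NormedAddCommGroup E]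

theorem integralFunctional_zero {Φ : α → E → ℝ} (hΦ : ∀ᵐ x ∂μ, Φ x 0 = 0) :
    integralFunctional μ Φ 0 = 0 :=
  lintegral_eq_zero_of_ae_eq_zero (hΦ.mono fun x hx => by simp [hx])

theorem integralFunctional_const_lt_top [ProperSpace E] [IsFiniteMeasure μ] {G : E → ℝ}
    (hG : Continuous G) {g : α → E} {R : ℝ} (hR : ∀ x, ‖g x‖ ≤ R) :
    integralFunctional μ (fun _ => G) g < ⊤ := by
  obtain ⟨B, hB⟩ := (isCompact_closedBall (0 : E) R).exists_bound_of_continuousOn hG.continuousOn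
  calc integralFunctional μ (fun _ => G) g ≤ ∫⁻ _, ENNReal.ofReal B ∂μ :=
        lintegral_mono fun x => ENNReal.ofReal_le_ofReal
          ((le_abs_self _).trans (hB _ (mem_closedBall_zero_iff.2 (hR x))))
    _ < ⊤ := by
        rw [lintegral_const]
        exact ENNReal.mul_lt_top ENNReal.ofReal_lt_top (measure_lt_top μ _)

variable {N : ℕ} {p : ℝ≥0∞} {Ω Ω' : Set (Eucl N)} {φ ψ : Eucl N → ℝ}

-- A convex function on a ball is bounded by its values at the vertices of a polytope around it.
theorem IsConvexFluxPotential.integralFunctional_lt_top {Q : Eucl N → Eucl N → ℝ}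
    (hQ : IsConvexFluxPotential p Ω Q) (hΩ : MeasurableSet Ω)
    (hloc : ∀ y, LocallyIntegrableOn (fun x => Q x y) Ω volume) {g : Eucl N → Eucl N}
    (hg : Continuous g) (hgc : HasCompactSupport g) (hgΩ : tsupport g ⊆ Ω) :
    integralFunctional (leb Ω) Q g < ⊤ := by
  obtain ⟨R, hR⟩ := hgc.exists_bound_of_continuous hg
  obtain ⟨t, ht, -⟩ :=
    (convex_closedBall (0 : Eucl N) R).exists_subset_interior_convexHull_finset_of_isCompact
      (isCompact_closedBall _ _) univ_mem
  have hle : ∀ x ∈ Ω, Q x (g x) ≤ (tsupport g).indicator (fun x => ∑ v ∈ t, Q x v) x := by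
    intro x hx
    by_cases hxs : x ∈ tsupport g
    · rw [Set.indicator_of_mem hxs]
      obtain ⟨v, hv, hv'⟩ := (hQ.convexOn x hx).exists_ge_of_mem_convexHull
        (t := (t : Set (Eucl N))) (Set.subset_univ _)
        (interior_subset (ht (mem_closedBall_zero_iff.2 (hR x))))
      exact hv'.trans (Finset.single_le_sum (fun w _ => hQ.nonneg hx w) hv)
    · rw [Set.indicator_of_notMem hxs, image_eq_zero_of_notMem_tsupport hxs, hQ.map_zero x hx]
  have hint : IntegrableOn (fun x => ∑ v ∈ t, Q x v) (tsupport g) volume :=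
    integrable_finsetSum _ fun v _ => (hloc v).integrableOn_compact_subset hgΩ hgc
  have hint' : Integrable ((tsupport g).indicator fun x => ∑ v ∈ t, Q x v) (leb Ω) :=
    ((integrable_indicator_iff (isClosed_tsupport g).measurableSet).2 hint).restrict
  exact (setLIntegral_mono' hΩ fun x hx => ENNReal.ofReal_le_ofReal (hle x hx)).trans_lt
    hint'.lintegral_lt_top

variable [Fact (1 ≤ p)] {hsub : Ω ⊆ Ω'} {hb : Bornology.IsBounded Ω}

/-- The element `(φ, 0, ψ)` of the energy space, for test functions `φ` and `ψ`. -/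
def testElement (p : ℝ≥0∞) [Fact (1 ≤ p)] (hsub : Ω ⊆ Ω') (hb : Bornology.IsBounded Ω)
    (hφ : IsTestFunction Ω φ) (hψ : IsTestFunction Ω ψ) : EnergySpace p hsub hb :=
  ⟨(hφ.toSobolev p, 0, (hψ.memLp 2).toLp ψ, (hφ.memLp 2).toLp φ), by
    have h0 : ((0 : Lp ℝ p (leb Ω')) : Eucl N → ℝ) =ᵐ[leb Ω] 0 :=
      ae_mono (Measure.restrict_mono hsub le_rfl) (Lp.coeFn_zero ℝ p (leb Ω'))
    refine ⟨integral_eq_zero_of_ae h0, ?_⟩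
    filter_upwards [h0, (hφ.memLp 2).coeFn_toLp, (hφ.memLp p).coeFn_toLp] with x hx0 hx2 hxp
    exact hx2.trans (((congrArg₂ (· - ·) hxp hx0).trans (sub_zero _)).symm)⟩

variable (hφ : IsTestFunction Ω φ) (hψ : IsTestFunction Ω ψ)

theorem coeFn_gradientᵢ_testElement :
    gradientᵢ p hsub hb (testElement p hsub hb hφ hψ) =ᵐ[leb Ω] gradient φ :=
  (hφ.memLp_gradient p).coeFn_toLp

theorem coeFn_gradientₑ_testElement :
    gradientₑ p hsub hb (testElement p hsub hb hφ hψ) =ᵐ[leb Ω'] 0 :=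
  Lp.coeFn_zero (Eucl N) p (leb Ω')

theorem coeFn_ionicState_testElement :
    ionicState p hsub hb (testElement p hsub hb hφ hψ) =ᵐ[leb Ω] fun x => (φ x, ψ x) := by
  filter_upwards [coeFn_lpProd ((hφ.memLp 2).toLp φ, (hψ.memLp 2).toLp ψ),
    (hφ.memLp 2).coeFn_toLp, (hψ.memLp 2).coeFn_toLp] with x hx hxφ hxψ
  exact hx.trans (Prod.ext hxφ hxψ)

theorem nonnegEnergy_testElement_lt_top {Qᵢ Qₑ : Eucl N → Eucl N → ℝ} (hΩ : MeasurableSet Ω)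
    (hΩ' : MeasurableSet Ω') (hQᵢ : IsConvexFluxPotential p Ω Qᵢ)
    (hQₑ : IsConvexFluxPotential p Ω' Qₑ)
    (hloc : ∀ y, LocallyIntegrableOn (fun x => Qᵢ x y) Ω volume) {G : ℝ × ℝ → ℝ}
    (hG : Continuous G) : nonnegEnergy Qᵢ Qₑ G (testElement p hsub hb hφ hψ) < ⊤ := by
  have := isFiniteMeasure_leb hb
  rw [nonnegEnergy, integralFunctional_congr (coeFn_gradientᵢ_testElement hφ hψ),
    integralFunctional_congr (coeFn_gradientₑ_testElement hφ hψ),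
    integralFunctional_congr (coeFn_ionicState_testElement hφ hψ),
    integralFunctional_zero ((ae_restrict_mem hΩ').mono hQₑ.map_zero), add_zero]
  obtain ⟨R, hR⟩ := hφ.hasCompactSupport.exists_bound_of_continuous hφ.contDiff.continuous
  obtain ⟨S, hS⟩ := hψ.hasCompactSupport.exists_bound_of_continuous hψ.contDiff.continuous
  exact ENNReal.add_lt_top.2 ⟨hQᵢ.integralFunctional_lt_top hΩ hloc hφ.continuous_gradient
    hφ.hasCompactSupport_gradient ((tsupport_gradient_subset φ).trans hφ.tsupport_subset),
    integralFunctional_const_lt_top hG fun x => max_le_max (hR x) (hS x)⟩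

theorem dense_image_jMap (hΩ : IsOpen Ω) {D : Set (EnergySpace p hsub hb)}
    (hD : ∀ (φ ψ : Eucl N → ℝ) (hφ : IsTestFunction Ω φ) (hψ : IsTestFunction Ω ψ),
      testElement p hsub hb hφ hψ ∈ D) : Dense (jMap p hsub hb '' D) := by
  let e := (WithLp.prodContinuousLinearEquiv 2 ℝ (Lp ℝ 2 (leb Ω)) (Lp ℝ 2 (leb Ω))).symm
  have hdense := e.surjective.denseRange.dense_image e.continuous
    ((dense_testSubmodule hΩ).prod (dense_testSubmodule hΩ))
  refine hdense.mono ?_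
  rintro _ ⟨⟨f, g⟩, ⟨⟨φ, hφ, rfl⟩, ⟨ψ, hψ, rfl⟩⟩, rfl⟩
  exact ⟨_, hD φ ψ hφ hψ, rfl⟩

end FiniteEnergy

section ExtendedReal

theorem coe_sub_real_ne_bot (a : ℝ≥0∞) (r : ℝ) : (a : EReal) - r ≠ ⊥ := by
  induction a with
  | top => simp
  | coe a => exact EReal.coe_ne_bot (a - r)

theorem coe_sub_real_lt_top {a : ℝ≥0∞} {r : ℝ} : (a : EReal) - r < ⊤ ↔ a < ⊤ := by
  induction a with
  | top => simp
  | coe a => exact iff_of_true (EReal.coe_lt_top (a - r)) ENNReal.coe_lt_top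

theorem mem_effDom_iff_of_eq_sub {X : Type*} {E : X → EReal} {K : X → ℝ≥0∞} {r : X → ℝ}
    (hE : ∀ z, E z = K z - r z) {z : X} : z ∈ effDom E ↔ K z < ⊤ := by
  rw [effDom, Set.mem_ofPred_eq, hE, coe_sub_real_lt_top]

theorem coe_ennreal_lt_top {a : ℝ≥0∞} : (a : EReal) < ⊤ ↔ a < ⊤ := by
  simpa only [EReal.coe_zero, sub_zero] using coe_sub_real_lt_top (a := a) (r := 0)

theorem le_toNNReal_of_coe_sub_le {a : ℝ≥0∞} {r c : ℝ} (h : (a : EReal) - r ≤ c) :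
    a ≤ (c + r).toNNReal := by
  induction a with
  | top => simp at h
  | coe a =>
    have h' : (a : ℝ) - r ≤ c := EReal.coe_le_coe_iff.1 h
    exact ENNReal.coe_le_coe.2 (NNReal.le_toNNReal_of_coe_le (by linarith))

theorem lowerSemicontinuous_of_eq_sub {X : Type*} [TopologicalSpace X] {E : X → EReal}
    {K : X → ℝ≥0∞} {r : X → ℝ} (hE : ∀ x, E x = K x - r x) (hK : LowerSemicontinuous K)
    (hr : Continuous r) : LowerSemicontinuous E := by
  have hK' : LowerSemicontinuous fun x => (K x : EReal) :=
    continuous_coe_ennreal_ereal.comp_lowerSemicontinuous hK fun _ _ h =>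
      EReal.coe_ennreal_le_coe_ennreal_iff.2 h
  have hr' : LowerSemicontinuous fun x => ((-r x : ℝ) : EReal) :=
    (continuous_coe_real_ereal.comp hr.neg).lowerSemicontinuous
  rw [funext hE]
  exact hK'.add' hr' fun x => EReal.continuousAt_add (Or.inr (EReal.coe_ne_bot _))
    (Or.inr (EReal.coe_ne_top _))

end ExtendedReal

section Elliptic

variable {V H : Type*} [NormedAddCommGroup V] [NormedSpace ℝ V] [NormedAddCommGroup H]
  [InnerProductSpace ℝ H] {E : V → EReal} {j : V →L[ℝ] H} {K : V → ℝ≥0∞} {ω c : ℝ}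

theorem shifted_eq_sub (hE : ∀ z, E z = K z - (ω / 2 * ‖j z‖ ^ 2 + c : ℝ)) :
    shifted E j ω = fun z => (K z : EReal) - c := by
  ext z
  rw [shifted, hE, sub_eq_add_neg, ← EReal.coe_neg, add_assoc, ← EReal.coe_add,
    neg_add_rev, neg_add_cancel_right, EReal.coe_neg, ← sub_eq_add_neg]

theorem isJElliptic_of_eq_sub (hV : IsReflexiveSpace V)
    (hE : ∀ z, E z = K z - (ω / 2 * ‖j z‖ ^ 2 + c : ℝ))
    (hK : IsConvexFun fun z => (K z : EReal))
    (hbdd : ∀ M : NNReal, Bornology.IsBounded {z | K z ≤ M}) : IsJElliptic E j := by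
  refine ⟨ω, ?_, fun d => hV.isCompact_closure ((hbdd (d + c).toNNReal).subset fun z hz => ?_)⟩
  · rw [shifted_eq_sub hE]
    exact hK.sub_const c
  · rw [shifted_eq_sub hE] at hz
    exact le_toNNReal_of_coe_sub_le hz

end Elliptic

section Main

variable {N : ℕ} {p : ℝ≥0∞} [Fact (1 ≤ p)] {Ω Ω' : Set (Eucl N)} {hsub : Ω ⊆ Ω'}
  {hb : Bornology.IsBounded Ω}

theorem effDom_energy {Qᵢ Qₑ : Eucl N → Eucl N → ℝ} (hΩ : MeasurableSet Ω)
    (hΩ' : MeasurableSet Ω') (hQᵢ : IsConvexFluxPotential p Ω Qᵢ)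
    (hQₑ : IsConvexFluxPotential p Ω' Qₑ) {F : ℝ × ℝ → ℝ} {ω C : ℝ}
    (hG : IsConvexIntegrand (leb Ω) fun _ => addQuadratic F ω C) :
    effDom (energy p hsub hb Qᵢ Qₑ F) =
      {z | energyᵢ Qᵢ z < ⊤ ∧ energyₑ Qₑ z < ⊤ ∧ energyF F z < ⊤} := by
  ext z
  rw [mem_effDom_iff_of_eq_sub (energy_eq hΩ hΩ' hQᵢ hQₑ hG)]
  simp only [nonnegEnergy, ENNReal.add_lt_top, and_assoc, Set.mem_ofPred_eq, energyᵢ_eq hΩ hQᵢ,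
    energyₑ_eq hΩ' hQₑ, energyF_eq hG, coe_ennreal_lt_top, coe_sub_real_lt_top]

end Main

end Bidomain

open Bidomain in
theorem lemma1_general {N : ℕ} {p : ℝ≥0∞} [Fact (1 ≤ p)] (hp₁ : 1 < p) (hp₂ : p ≠ ⊤)
    {Ω Ω' : Set (Eucl N)} (hΩ : IsContinuousDomain Ω) (hΩ' : IsContinuousDomain Ω')
    (hsub : Ω ⊆ Ω') {Qᵢ Qₑ : Eucl N → Eucl N → ℝ} (hQᵢ : IsConvexFluxPotential p Ω Qᵢ)
    (hQₑ : IsConvexFluxPotential p Ω' Qₑ) {F : ℝ × ℝ → ℝ} (hF : IsSemiconvex F) :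
    (∀ z, energy p hsub hΩ.isBounded Qᵢ Qₑ F z ≠ ⊥) ∧
    LowerSemicontinuous (energy p hsub hΩ.isBounded Qᵢ Qₑ F) ∧
    IsJElliptic (energy p hsub hΩ.isBounded Qᵢ Qₑ F) (jMap p hsub hΩ.isBounded) ∧
    effDom (energy p hsub hΩ.isBounded Qᵢ Qₑ F) =
      {z | energyᵢ Qᵢ z < ⊤ ∧ energyₑ Qₑ z < ⊤ ∧ energyF F z < ⊤} ∧
    ((∀ y, LocallyIntegrableOn (fun x => Qᵢ x y) Ω volume) →
      Dense (jMap p hsub hΩ.isBounded '' effDom (energy p hsub hΩ.isBounded Qᵢ Qₑ F))) := by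
  have hm := hΩ.isOpen.measurableSet
  have hm' := hΩ'.isOpen.measurableSet
  obtain ⟨ω, C, hconv, hle⟩ := hF.exists_convexOn_addQuadratic
  have hG : IsConvexIntegrand (leb Ω) fun _ => addQuadratic F ω C :=
    isConvexIntegrand_const hconv fun z => (sq_nonneg _).trans (hle z)
  have hE := energy_eq (hsub := hsub) (hb := hΩ.isBounded) hm hm' hQᵢ hQₑ hG
  have hIᵢ := hQᵢ.isConvexIntegrand hm
  have hIₑ := hQₑ.isConvexIntegrand hm'
  refine ⟨fun z => hE z ▸ coe_sub_real_ne_bot _ _,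
    lowerSemicontinuous_of_eq_sub hE (lowerSemicontinuous_nonnegEnergy hIᵢ hIₑ hG) (by fun_prop),
    isJElliptic_of_eq_sub (isReflexiveSpace_energySpace hp₁ hp₂ hm hsub _ hΩ'.isBounded) hE
      (isConvexFun_nonnegEnergy hIᵢ hIₑ hG)
      (isBounded_setOf_nonnegEnergy_le hp₂ hΩ hΩ' hQᵢ hQₑ hle),
    effDom_energy hm hm' hQᵢ hQₑ hG, fun hloc => ?_⟩
  exact dense_image_jMap hΩ.isOpen fun φ ψ hφ hψ => (mem_effDom_iff_of_eq_sub hE).2 <|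
    nonnegEnergy_testElement_lt_top hφ hψ hm hm' hQᵢ hQₑ hloc hconv.locallyLipschitz.continuous

end

theorem lemma1 {N : ℕ} (p : ENNReal) [Fact (1 ≤ p)] (hp₁ : 1 < p) (hp₂ : p ≠ ⊤)
    {Ω Ω' : Set (Bidomain.Eucl N)}
    (hΩ : Bidomain.IsC1Domain Ω) (hΩ' : Bidomain.IsC1Domain Ω') (hsub : Ω ⊆ Ω')
    (Qᵢ Qₑ : Bidomain.Eucl N → Bidomain.Eucl N → ℝ)
    (hQᵢ : Bidomain.IsFluxPotential p Ω Qᵢ) (hQₑ : Bidomain.IsFluxPotential p Ω' Qₑ)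
    (F : ℝ × ℝ → ℝ) (hF : ContDiff ℝ 1 F) (hF' : Bidomain.IsSemiconvex F) :
    (∀ z, Bidomain.energy p hsub hΩ.isBounded Qᵢ Qₑ F z ≠ ⊥) ∧
    LowerSemicontinuous (Bidomain.energy p hsub hΩ.isBounded Qᵢ Qₑ F) ∧
    Bidomain.IsJElliptic (Bidomain.energy p hsub hΩ.isBounded Qᵢ Qₑ F)
      (Bidomain.jMap p hsub hΩ.isBounded) ∧
    Bidomain.effDom (Bidomain.energy p hsub hΩ.isBounded Qᵢ Qₑ F) =
      {z | Bidomain.energyᵢ Qᵢ z < ⊤ ∧ Bidomain.energyₑ Qₑ z < ⊤ ∧ Bidomain.energyF F z < ⊤} ∧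
    ((∀ y, MeasureTheory.LocallyIntegrableOn (fun x => Qᵢ x y) Ω MeasureTheory.volume) →
      Dense (Bidomain.jMap p hsub hΩ.isBounded ''
        Bidomain.effDom (Bidomain.energy p hsub hΩ.isBounded Qᵢ Qₑ F))) :=
  lemma1_general hp₁ hp₂ hΩ.isContinuousDomain hΩ'.isContinuousDomain hsub
    hQᵢ.isConvexFluxPotential hQₑ.isConvexFluxPotential hF'
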